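/- **Setting.** Let $X$ be a measurable space, let $Y$ be a real separable Hilbert space, and let $\mathcal H$ be a separable real reproducing kernel Hilbert space of functions on $X$ with kernel $k$, whose sections $k(\cdot,t)$ are measurable; put $\phi(x)=k(x,\cdot)$. For $u\in\mathcal H$ and $v$ in a Hilbert space, $v\otimes u$ is the operator $h\mapsto\langle h,u\rangle v$; $\mathcal S_2(\mathcal H,Y)$ is the space of Hilbert–Schmidt operators from $\mathcal H$ to $Y$. For a compact self-adjoint operator $A$, $g(A)=\sum_\mu g(\mu)P_\mu$, where $\mu$ runs over the eigenvalues of $A$ and $P_\mu$ is the orthogonal projection onto the eigenspace. Let $p_X,q_X$ be probability measures on $X$ and $p(dy|x)$ a Markov kernel from $X$ to $Y$; the source distribution is $p(dx,dy)=p_X(dx)\,p(dy|x)$, the target distribution is $q(dx,dy)=q_X(dx)\,p(dy|x)$, and $f^*(x)=\int_Y y\,p(dy|x)$ is the regression function. Assume: 1. $k(x,x)\le\kappa^2$ for all $x\in X$, where $\kappa\ge 0$. 2. $dq_X=\beta\,dp_X$ with a measurable $\beta:X\to[0,\infty)$ such that $\beta(x)\le b$ for all $x$. 3. $\|y\|_Y\le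 M'$ for $p$-almost every $(x,y)$. 4. (Source condition.) $f^*(x)=C_*\phi(x)$ for $q_X$-almost every $x$, with $C_*\in\mathcal S_2(\mathcal H,Y)$, and $C_*=C_o\,\varphi(C_X)$ for some $C_o\in\mathcal S_2(\mathcal H,Y)$, where $C_X=\mathbb E_{q_X}[\phi(x)\otimes\phi(x)]$ and $\varphi:[0,\infty)\to[0,\infty)$ is an index function, i.e. continuous, strictly increasing, with $\varphi(0)=0$. Let $s\ge b\kappa^2$ and let $g_\lambda:[0,s]\to\mathbb R$, $0<\lambda\le s$, be a regularization family: there are positive constants $D,B,\gamma$ with $$|\sigma g_\lambda(\sigma)|\le D,\qquad |g_\lambda(\sigma)|\le \frac B\lambda,\qquad |1-\sigma g_\lambda(\sigma)|\le\gamma\qquad\text{for all }\lambda,\sigma\in(0,s].$$ Let $\nu>0$ and $\gamma_\nu$ be such that $|1-\sigma g_\lambda(\sigma)|\,\sigma^\nu\le\gamma_\nu\lambda^\nu$ for all $\lambda,\sigma\in(0,s]$ (for example, $\nu$ is the qualification of the family, the largest such exponent). Suppose that $\nu$ covers $\psi(t)=\varphi(t)\sqrt t$ with constant $c>0$: $$c\,\frac{t^\nu}{\psi(t)}\le\inf_{t\le\sigma\le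 s}\frac{\sigma^\nu}{\psi(\sigma)}\qquad\text{for all }0<t\le s.$$ For $n\ge1$ and a sample $\mathbf z=((x_i,y_i))_{i=1}^n$ drawn independently from $p$, let $$\widehat C_X^\beta=\frac1n\sum_{i=1}^n\beta(x_i)\,\phi(x_i)\otimes\phi(x_i),\quad \widehat C_{YX}^\beta=\frac1n\sum_{i=1}^n\beta(x_i)\,y_i\otimes\phi(x_i),\quad \widehat f_{\mathbf z,\lambda}(x)=\widehat C_{YX}^\beta\,g_\lambda(\widehat C_X^\beta)\,\phi(x).$$ Let $\mathcal N(\lambda)=\operatorname{Tr}\big(C_X(C_X+\lambda I)^{-1}\big)$. **Theorem.** Let $0<\delta<1$ and let $0<\lambda\le s$ satisfy $$2\left(\frac{2b\kappa^2}{\sqrt\lambda\,n}+\sqrt{\frac{b\kappa^2\mathcal N(\lambda)}{n}}\right)\log\frac2\delta\le\frac{\sqrt\lambda}{2}.$$ Then with probability at least $1-\delta$ over $\mathbf z$ (that is, on a measurable set of samples of at least this probability), $$\big\|f^*-\widehat f_{\mathbf z,\lambda}\big\|_{L_2(q_X,Y)}\le\left(\frac{A_1}{n}\sqrt{\frac1\lambda}+A_2\sqrt{\frac{\mathcal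 N(\lambda)}{n}}\right)\log\frac2\delta+A_3\sqrt\lambda\,\varphi(\lambda),$$ where, with $\bar\nu=\lfloor\nu-\tfrac12\rfloor$ and $M=M'+\kappa\|C_*\|_{\mathcal S_2(\mathcal H,Y)}$, $$\begin{aligned} A_1&=2^{2\nu-\bar\nu+2}(\gamma_\nu+\gamma)\max(1,\tfrac1c)\,\bar\nu\,b\,\kappa^2\,\|C_*\|_{\mathcal S_2(\mathcal H,Y)}+10\,b\,M\,\kappa\,(B+D),\\ A_2&=2^{2\nu-\bar\nu+1}(\gamma_\nu+\gamma)\max(1,\tfrac1c)\,\bar\nu\,\sqrt b\,\kappa\,\|C_*\|_{\mathcal S_2(\mathcal H,Y)}+5\,M\sqrt b\,(B+D),\\ A_3&=2^{2\nu-\bar\nu}(\gamma_\nu+\gamma)\max(1,\tfrac1c)\,\|C_o\|_{\mathcal S_2(\mathcal H,Y)}. \end{aligned}$$ -/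

import Mathlib

open MeasureTheory ProbabilityTheory InnerProductSpace
open scoped ENNReal

noncomputable section

namespace CovariateShift

/-! ### Hilbert-Schmidt operators and traces -/

section Operators

variable {H Y : Type*} [NormedAddCommGroup H] [InnerProductSpace ℝ H] [CompleteSpace H]
  [NormedAddCommGroup Y] [InnerProductSpace ℝ Y] [CompleteSpace Y]

/-- The index set of some fixed Hilbert basis of `H`. -/
def basisIndex (H : Type*) [NormedAddCommGroup H] [InnerProductSpace ℝ H] [CompleteSpace H] :
    Set H :=
  (exists_hilbertBasis ℝ H).choose

/-- Some fixed Hilbert (that is, complete orthonormal) basis of `H`. -/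
def someBasis (H : Type*) [NormedAddCommGroup H] [InnerProductSpace ℝ H] [CompleteSpace H] :
    HilbertBasis (basisIndex H) ℝ H :=
  (exists_hilbertBasis ℝ H).choose_spec.choose

/-- The squared Hilbert-Schmidt norm `∑ᵢ ‖T eᵢ‖²`, for a Hilbert basis `(eᵢ)`, as an extended
nonnegative real. It does not depend on the basis, see `hsNormSq_eq`. -/
def hsNormSq (T : H →L[ℝ] Y) : ℝ≥0∞ :=
  ∑' i, ‖T (someBasis H i)‖ₑ ^ 2

/-- `T ∈ S₂(H, Y)`: the operator `T` is Hilbert-Schmidt. -/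
def IsHilbertSchmidt (T : H →L[ℝ] Y) : Prop :=
  hsNormSq T ≠ ∞

/-- The Hilbert-Schmidt norm `‖T‖_{S₂(H, Y)}` (meaningful for Hilbert-Schmidt operators). -/
def hsNorm (T : H →L[ℝ] Y) : ℝ :=
  √(hsNormSq T).toReal

/-- The trace `∑ᵢ ⟨T eᵢ, eᵢ⟩` of a trace class operator. -/
def opTrace (T : H →L[ℝ] H) : ℝ :=
  ∑' i, ⟪T (someBasis H i), someBasis H i⟫_ℝ

/-- Parseval's identity. -/
theorem tsum_enorm_inner_sq {ι E : Type*} [NormedAddCommGroup E] [InnerProductSpace ℝ E]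
    (e : HilbertBasis ι ℝ E) (v : E) :
    ∑' i, ‖⟪v, e i⟫_ℝ‖ₑ ^ 2 = ‖v‖ₑ ^ 2 := by
  have h := e.hasSum_inner_mul_inner v v
  have hsq : ∀ i, ⟪v, e i⟫_ℝ * ⟪e i, v⟫_ℝ = ‖⟪v, e i⟫_ℝ‖ ^ 2 := fun i => by
    rw [real_inner_comm v (e i), Real.norm_eq_abs, sq_abs, sq]
  simp only [hsq, real_inner_self_eq_norm_sq] at h
  have hE : ∀ x : ℝ, ‖x‖ₑ ^ 2 = ENNReal.ofReal (‖x‖ ^ 2) := fun x => by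
    rw [ENNReal.ofReal_pow (norm_nonneg _), ofReal_norm]
  simp only [hE]
  rw [← ENNReal.ofReal_tsum_of_nonneg (fun _ => by positivity) h.summable, h.tsum_eq,
    ENNReal.ofReal_pow (norm_nonneg _), ofReal_norm]

theorem tsum_enorm_sq_eq_adjoint {ι κ : Type*} (e : HilbertBasis ι ℝ H)
    (f : HilbertBasis κ ℝ Y) (T : H →L[ℝ] Y) :
    ∑' i, ‖T (e i)‖ₑ ^ 2 = ∑' j, ‖T.adjoint (f j)‖ₑ ^ 2 := by
  simp only [← tsum_enorm_inner_sq f (T _), ← tsum_enorm_inner_sq e (T.adjoint _)]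
  rw [ENNReal.tsum_comm]
  simp only [ContinuousLinearMap.adjoint_inner_left, real_inner_comm]

/-- The Hilbert-Schmidt norm may be computed in any Hilbert basis. -/
theorem hsNormSq_eq {ι : Type*} (e : HilbertBasis ι ℝ H) (T : H →L[ℝ] Y) :
    hsNormSq T = ∑' i, ‖T (e i)‖ₑ ^ 2 := by
  rw [hsNormSq, tsum_enorm_sq_eq_adjoint (someBasis H) (someBasis Y),
    tsum_enorm_sq_eq_adjoint e (someBasis Y)]

/-! ### Functional calculus of compact self-adjoint operators -/

/-- The orthogonal projection of `H` onto the eigenspace `ker (A - μ I)`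
(it is zero if `μ` is not an eigenvalue of `A`). -/
def eigenProj (A : H →L[ℝ] H) (μ : ℝ) : H →L[ℝ] H :=
  (A - μ • ContinuousLinearMap.id ℝ H).ker.starProjection

/-- The functional calculus `g(A) h = ∑_μ g(μ) P_μ h` of a compact self-adjoint operator `A`
on `H`; the sum runs over the eigenvalues `μ` of `A` (zero included, if it is one), and `P_μ` is
the orthogonal projection onto the eigenspace of `μ`. -/
def specFun (g : ℝ → ℝ) (A : H →L[ℝ] H) (h : H) : H :=
  ∑' μ : ℝ, g μ • eigenProj A μ h

theorem eigenProj_of_eigenvector {A : H →L[ℝ] H} {μ : ℝ} {v : H} (hv : A v = μ • v) :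
    eigenProj A μ v = v := by
  rw [eigenProj, Submodule.starProjection_eq_self_iff]
  simp [LinearMap.mem_ker, hv]

theorem eigenProj_of_eigenvector_ne {A : H →L[ℝ] H} (hA : A.IsSymmetric) {μ μ' : ℝ}
    (hne : μ' ≠ μ) {v : H} (hv : A v = μ • v) : eigenProj A μ' v = 0 := by
  rw [eigenProj, Submodule.starProjection_apply_eq_zero_iff, Submodule.mem_orthogonal]
  intro w hw
  have hw' : A w = μ' • w := by simpa [LinearMap.mem_ker, sub_eq_zero] using hw
  have h : ⟪A w, v⟫_ℝ = ⟪w, A v⟫_ℝ := hA w v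
  rw [hw', hv, real_inner_smul_left, real_inner_smul_right] at h
  have h' : (μ' - μ) * ⟪w, v⟫_ℝ = 0 := by linarith
  exact (mul_eq_zero.mp h').resolve_left (sub_ne_zero.mpr hne)

/-- On an eigenvector, `g(A)` acts as multiplication by the value of `g` at the eigenvalue. -/
theorem specFun_of_eigenvector (g : ℝ → ℝ) {A : H →L[ℝ] H} (hA : A.IsSymmetric) {μ : ℝ}
    {v : H} (hv : A v = μ • v) : specFun g A v = g μ • v := by
  rw [specFun, tsum_eq_single μ, eigenProj_of_eigenvector hv]
  intro μ' hne
  rw [eigenProj_of_eigenvector_ne hA hne hv, smul_zero]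

/-- The effective dimension `N(λ) = Tr (C (C + λ I)⁻¹)`. -/
def effDim (C : H →L[ℝ] H) (lam : ℝ) : ℝ :=
  opTrace (C ∘L Ring.inverse (C + lam • ContinuousLinearMap.id ℝ H))

end Operators

/-! ### Index functions and regularization families -/

/-- `φ : [0, ∞) → [0, ∞)` is an index function: it is continuous and strictly increasing, and
`φ(0) = 0`. -/
structure IsIndexFunction (φ : ℝ → ℝ) : Prop where
  continuousOn : ContinuousOn φ (Set.Ici 0)
  strictMonoOn : StrictMonoOn φ (Set.Ici 0)
  map_zero : φ 0 = 0

/-- `(g_λ)`, `0 < λ ≤ s`, is a regularization family of functions `g_λ = g lam` on `[0, s]`, with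
constants `D`, `B` and `γ`. -/
structure IsRegularizationFamily (g : ℝ → ℝ → ℝ) (s D B γ : ℝ) : Prop where
  D_pos : 0 < D
  B_pos : 0 < B
  γ_pos : 0 < γ
  abs_mul_le : ∀ lam ∈ Set.Ioc 0 s, ∀ σ ∈ Set.Ioc 0 s, |σ * g lam σ| ≤ D
  abs_le : ∀ lam ∈ Set.Ioc 0 s, ∀ σ ∈ Set.Ioc 0 s, |g lam σ| ≤ B / lam
  abs_residual_le : ∀ lam ∈ Set.Ioc 0 s, ∀ σ ∈ Set.Ioc 0 s, |1 - σ * g lam σ| ≤ γ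

/-- The family `(g_λ)` satisfies the qualification inequality
`sup_{0 < σ ≤ s} |1 - σ g_λ(σ)| σ^ν ≤ γ_ν λ^ν` with exponent `ν > 0` and a constant `γ_ν`
independent of `λ`. The qualification of the family is the largest such exponent. -/
structure HasQualification (g : ℝ → ℝ → ℝ) (s ν γν : ℝ) : Prop where
  pos : 0 < ν
  residual_le : ∀ lam ∈ Set.Ioc 0 s, ∀ σ ∈ Set.Ioc 0 s,
    |1 - σ * g lam σ| * σ ^ ν ≤ γν * lam ^ ν

/-- The exponent `ν` covers the index function `ψ` with constant `c > 0`: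
`c t^ν / ψ(t) ≤ inf_{t ≤ σ ≤ s} σ^ν / ψ(σ)` for all `0 < t ≤ s`. -/
def Covers (ν s : ℝ) (ψ : ℝ → ℝ) (c : ℝ) : Prop :=
  0 < c ∧ ∀ t ∈ Set.Ioc 0 s, ∀ σ ∈ Set.Icc t s, c * (t ^ ν / ψ t) ≤ σ ^ ν / ψ σ

/-! ### Kernels, covariance operators and the estimator -/

section Learning

variable {X H : Type*} [NormedAddCommGroup H] [InnerProductSpace ℝ H] [CompleteSpace H]
  [RKHS ℝ H X ℝ]

/-- The reproducing kernel `k : X × X → ℝ` of a scalar-valued reproducing kernel Hilbert space. -/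
def scalarKernel (H : Type*) {X : Type*} [NormedAddCommGroup H] [InnerProductSpace ℝ H]
    [CompleteSpace H] [RKHS ℝ H X ℝ] (x t : X) : ℝ :=
  RKHS.kernel H x t 1

/-- The feature map `x ↦ k(x, ·)`. -/
def featureMap (H : Type*) {X : Type*} [NormedAddCommGroup H] [InnerProductSpace ℝ H]
    [CompleteSpace H] [RKHS ℝ H X ℝ] (x : X) : H :=
  RKHS.kerFun H x 1

theorem featureMap_apply (x t : X) : featureMap H x t = scalarKernel H t x :=
  RKHS.kerFun_apply H x 1 t

theorem inner_featureMap (f : H) (x : X) : ⟪featureMap H x, f⟫_ℝ = f x := by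
  simp [featureMap]

/-- The covariance operator `C_X = E_q[φ(x) ⊗ φ(x)]`. -/
def covOp (H : Type*) {X : Type*} [NormedAddCommGroup H] [InnerProductSpace ℝ H]
    [CompleteSpace H] [RKHS ℝ H X ℝ] [MeasurableSpace X] (qX : Measure X) : H →L[ℝ] H :=
  ∫ x, rankOne ℝ (featureMap H x) (featureMap H x) ∂qX

/-- The weighted empirical covariance operator `(1/n) ∑ᵢ β(xᵢ) φ(xᵢ) ⊗ φ(xᵢ)`. -/
def empCovOp (H : Type*) {X Y : Type*} [NormedAddCommGroup H] [InnerProductSpace ℝ H]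
    [CompleteSpace H] [RKHS ℝ H X ℝ] {n : ℕ} (β : X → ℝ) (z : Fin n → X × Y) : H →L[ℝ] H :=
  (1 / n : ℝ) • ∑ i, β (z i).1 • rankOne ℝ (featureMap H (z i).1) (featureMap H (z i).1)

/-- The weighted empirical cross-covariance operator `(1/n) ∑ᵢ β(xᵢ) yᵢ ⊗ φ(xᵢ)`. -/
def empCrossCovOp (H : Type*) {X Y : Type*} [NormedAddCommGroup H] [InnerProductSpace ℝ H]
    [CompleteSpace H] [RKHS ℝ H X ℝ] [NormedAddCommGroup Y] [InnerProductSpace ℝ Y]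
    {n : ℕ} (β : X → ℝ) (z : Fin n → X × Y) : H →L[ℝ] Y :=
  (1 / n : ℝ) • ∑ i, β (z i).1 • rankOne ℝ (z i).2 (featureMap H (z i).1)

/-- The estimator `x ↦ Ĉ_YX g_λ(Ĉ_X) φ(x)` built from the filter function `gl = g_λ`. -/
def estimator (H : Type*) {X Y : Type*} [NormedAddCommGroup H] [InnerProductSpace ℝ H]
    [CompleteSpace H] [RKHS ℝ H X ℝ] [NormedAddCommGroup Y] [InnerProductSpace ℝ Y]
    {n : ℕ} (β : X → ℝ) (gl : ℝ → ℝ) (z : Fin n → X × Y) (x : X) : Y :=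
  empCrossCovOp H β z (specFun gl (empCovOp H β z) (featureMap H x))

/-- The regression function `f*(x) = ∫ y p(dy | x)`. -/
def regressionFun {X Y : Type*} [MeasurableSpace X] [MeasurableSpace Y] [NormedAddCommGroup Y]
    [InnerProductSpace ℝ Y] (K : Kernel X Y) (x : X) : Y :=
  ∫ y, y ∂(K x)

/-- `𝓑_{n,λ} = 2 (2 b κ² / (√λ n) + √(b κ² N(λ) / n))`. -/
def Bnl (n : ℕ) (lam b κ N : ℝ) : ℝ :=
  2 * (2 * b * κ ^ 2 / (√lam * n) + √(b * κ ^ 2 * N / n))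

end Learning

end CovariateShift

end

/-!
Write `T` for the covariance operator of the target, `Th` for its weighted empirical version and
`S = (T + lam) ^ (-1/2)`. The `L²(qX)` norm of `x ↦ A (φ x)` is the Hilbert-Schmidt norm of
`A ∘ √T`, and for `A = Cstar - Cyx g(Th)` the decomposition

  `Cstar - Cyx g(Th) = Cstar (1 - Th g(Th)) - (Cyx - Cstar Th) g(Th)`

splits the error into a bias and a sample error.

The condition on `lam` makes `‖(T - Th) S‖ ≤ √lam / 2`, so that `‖(T + lam) x‖ ≤ 2 ‖(Th + lam) x‖`,
and Heinz's inequality yields `‖(T + lam) ^ θ (Th + lam) ^ (-θ)‖ ≤ 2 ^ θ` for `θ ∈ [0, 1]`. This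
exchanges powers of `T + lam` for powers of `Th + lam`, on which the bounds for `g` apply. In the
bias the source condition produces the exponent `ν - 1/2`, which may exceed `1`: only its fractional
part is treated by Heinz's inequality, and each of the `⌊ν - 1/2⌋` integer steps costs one
deviation `‖(T - Th) S‖`.

It remains to bound the Hilbert-Schmidt norms of `(Th - T) S` and `(Cyx - Cstar Th) S`, which are
averages of independent centred vectors of a Hilbert space. Their variances involve
`∫ ‖S (φ x)‖² dqX = effDim T lam`. Pinelis' inequality, complemented by Chebyshev's for small
`log (2 / δ)`, bounds both of them outside an event of probability at most `δ`.
-/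

open MeasureTheory ProbabilityTheory InnerProductSpace
open scoped ENNReal

noncomputable section

namespace CovariateShift

/-! ### Operators that are diagonal in a Hilbert basis -/

section Diagonal

variable {ι κ H Y : Type*} [NormedAddCommGroup H] [InnerProductSpace ℝ H]
  [NormedAddCommGroup Y] [InnerProductSpace ℝ Y]

theorem countable_of_hilbertBasis [TopologicalSpace.SeparableSpace H] (e : HilbertBasis ι ℝ H) :
    Countable ι := by
  refine Pairwise.countable_of_isOpen_disjoint (s := fun i => Metric.ball (e i) (1 / 2))
    (fun i j hij => Metric.ball_disjoint_ball ?_) (fun i => Metric.isOpen_ball)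
    (fun i => ⟨e i, Metric.mem_ball_self (by norm_num)⟩)
  have hdist : ‖e i - e j‖ ^ 2 = 2 := by
    rw [norm_sub_sq_real, e.orthonormal.1 i, e.orthonormal.1 j, e.orthonormal.2 hij]
    norm_num
  rw [dist_eq_norm]
  nlinarith [norm_nonneg (e i - e j)]

theorem eq_of_apply_hilbertBasis_eq (e : HilbertBasis ι ℝ H) {A B : H →L[ℝ] Y}
    (h : ∀ i, A (e i) = B (e i)) : A = B := by
  refine ContinuousLinearMap.ext_on (s := Set.range e) ?_ (Set.forall_mem_range.2 h)
  rw [Submodule.dense_iff_topologicalClosure_eq_top]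
  exact e.dense_span

theorem hasSum_inner_sq (e : HilbertBasis ι ℝ H) (x : H) :
    HasSum (fun i => ⟪e i, x⟫_ℝ ^ 2) (‖x‖ ^ 2) := by
  have h := e.hasSum_inner_mul_inner x x
  rw [real_inner_self_eq_norm_sq] at h
  simpa only [real_inner_comm x, ← sq] using h

/-- `A` is diagonal in the Hilbert basis `e`, with eigenvalues `f`. Together with `diagOp`, this
serves as the functional calculus: functions of an operator are obtained by acting on `f`. -/
def IsDiag (e : HilbertBasis ι ℝ H) (f : ι → ℝ) (A : H →L[ℝ] H) : Prop :=
  ∀ i, A (e i) = f i • e i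

namespace IsDiag

variable {e : HilbertBasis ι ℝ H} {f g : ι → ℝ} {A B : H →L[ℝ] H}

theorem unique (hA : IsDiag e f A) (hB : IsDiag e f B) : A = B :=
  eq_of_apply_hilbertBasis_eq e fun i => by rw [hA i, hB i]

theorem congr (hA : IsDiag e f A) (h : ∀ i, f i = g i) : IsDiag e g A := fun i => by
  rw [hA i, h i]

protected theorem one : IsDiag e (fun _ => 1) (1 : H →L[ℝ] H) := fun i => by simp

theorem add (hA : IsDiag e f A) (hB : IsDiag e g B) : IsDiag e (fun i => f i + g i) (A + B) :=
  fun i => by simp [hB i, hA i, add_smul]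

theorem sub (hA : IsDiag e f A) (hB : IsDiag e g B) : IsDiag e (fun i => f i - g i) (A - B) :=
  fun i => by simp [hB i, hA i, sub_smul]

theorem smul (c : ℝ) (hA : IsDiag e f A) : IsDiag e (fun i => c * f i) (c • A) :=
  fun i => by simp [hA i, smul_smul]

theorem mul (hA : IsDiag e f A) (hB : IsDiag e g B) : IsDiag e (fun i => f i * g i) (A * B) :=
  fun i => by simp [hB i, hA i, smul_smul, mul_comm]

theorem inner_apply (hA : IsDiag e f A) (x : H) (i : ι) : ⟪e i, A x⟫_ℝ = f i * ⟪e i, x⟫_ℝ := by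
  classical
  have hsum : HasSum (fun j => e.repr x j * (f j * ⟪e i, e j⟫_ℝ)) ⟪e i, A x⟫_ℝ := by
    simpa only [map_smul, hA _, innerSL_apply_apply, smul_eq_mul] using
      ((e.hasSum_repr x).mapL A).mapL (innerSL ℝ (e i))
  have hsingle := hasSum_single (f := fun j => e.repr x j * (f j * ⟪e i, e j⟫_ℝ)) i fun j hj => by
    rw [e.orthonormal.2 hj.symm, mul_zero, mul_zero]
  rw [hsum.unique hsingle, e.repr_apply_apply, real_inner_self_eq_norm_sq, e.orthonormal.1 i]
  ring

theorem inner_apply_self (hA : IsDiag e f A) (i : ι) : ⟪e i, A (e i)⟫_ℝ = f i := by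
  rw [hA.inner_apply, real_inner_self_eq_norm_sq, e.orthonormal.1 i, one_pow, mul_one]

theorem eigenvalue_mem_Icc (hA : IsDiag e f A) (hpos : A.IsPositive) {C : ℝ} (hC : ‖A‖ ≤ C)
    (i : ι) : f i ∈ Set.Icc 0 C := by
  have h := A.le_of_opNorm_le hC (e i)
  rw [hA i, norm_smul, e.orthonormal.1 i, mul_one, mul_one] at h
  exact ⟨hA.inner_apply_self i ▸ hpos.inner_nonneg_right (e i), (le_abs_self _).trans h⟩

theorem hasSum_norm_sq (hA : IsDiag e f A) (x : H) :
    HasSum (fun i => f i ^ 2 * ⟪e i, x⟫_ℝ ^ 2) (‖A x‖ ^ 2) := by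
  simpa only [hA.inner_apply, mul_pow] using hasSum_inner_sq e (A x)

theorem norm_apply_le_of_le (hA : IsDiag e f A) (hB : IsDiag e g B) (h : ∀ i, |f i| ≤ |g i|)
    (x : H) : ‖A x‖ ≤ ‖B x‖ :=
  (sq_le_sq₀ (norm_nonneg _) (norm_nonneg _)).1 <|
    hasSum_le (fun i => mul_le_mul_of_nonneg_right (sq_le_sq.mpr (h i)) (sq_nonneg _))
      (hA.hasSum_norm_sq x) (hB.hasSum_norm_sq x)

theorem norm_le (hA : IsDiag e f A) {C : ℝ} (hC : 0 ≤ C) (h : ∀ i, |f i| ≤ C) : ‖A‖ ≤ C := by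
  refine A.opNorm_le_bound hC fun x => ?_
  have := hA.norm_apply_le_of_le (IsDiag.one.smul C)
    (fun i => by rw [mul_one, abs_of_nonneg hC]; exact h i) x
  simpa [norm_smul, abs_of_nonneg hC] using this

theorem isSymmetric (hA : IsDiag e f A) : A.IsSymmetric := fun x y => by
  change ⟪A x, y⟫_ℝ = ⟪x, A y⟫_ℝ
  refine (e.hasSum_inner_mul_inner (A x) y).unique ?_
  convert e.hasSum_inner_mul_inner x (A y) using 2 with i
  have h : ⟪A x, e i⟫_ℝ = f i * ⟪x, e i⟫_ℝ := by
    rw [real_inner_comm, hA.inner_apply, real_inner_comm]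
  rw [h, hA.inner_apply]
  ring

theorem adjoint_eq [CompleteSpace H] (hA : IsDiag e f A) : A.adjoint = A :=
  ((ContinuousLinearMap.eq_adjoint_iff A A).2 hA.isSymmetric).symm

end IsDiag

theorem memℓp_mul_of_abs_le {f : ι → ℝ} {C : ℝ} (hf : ∀ i, |f i| ≤ C)
    (v : lp (fun _ : ι => ℝ) 2) : Memℓp (fun i => f i * v i) 2 := by
  have hv := (lp.memℓp v).summable (by norm_num)
  refine memℓp_gen (.of_nonneg_of_le (fun i => by positivity) (fun i => ?_)
    (hv.mul_left (C ^ (2 : ℝ))))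
  simp only [Real.norm_eq_abs, abs_mul, ENNReal.toReal_ofNat, Real.rpow_two, mul_pow]
  have := hf i
  gcongr

/-- Multiplication by a bounded family, as an operator on `ℓ²`. -/
def lpMulCLM (f : ι → ℝ) {C : ℝ} (hf : ∀ i, |f i| ≤ C) :
    lp (fun _ : ι => ℝ) 2 →L[ℝ] lp (fun _ : ι => ℝ) 2 :=
  LinearMap.mkContinuous
    { toFun := fun v => ⟨fun i => f i * v i, memℓp_mul_of_abs_le hf v⟩
      map_add' := fun _ _ => lp.ext (funext fun _ => mul_add _ _ _)
      map_smul' := fun _ _ => lp.ext (funext fun _ => mul_left_comm _ _ _) }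
    |C| fun v => by
      refine (sq_le_sq₀ (norm_nonneg _) (by positivity)).1 ?_
      rw [mul_pow, ← Real.rpow_two, ← Real.rpow_two ‖v‖]
      refine hasSum_le (fun i => ?_) (lp.hasSum_norm (p := 2) (by norm_num) _)
        ((lp.hasSum_norm (p := 2) (by norm_num) v).mul_left (|C| ^ 2))
      simp only [LinearMap.coe_mk, AddHom.coe_mk, ENNReal.toReal_ofNat, Real.rpow_two,
        Real.norm_eq_abs, abs_mul, mul_pow]
      have := (hf i).trans (le_abs_self C)
      gcongr

theorem exists_isDiag (e : HilbertBasis ι ℝ H) {f : ι → ℝ} {C : ℝ} (hf : ∀ i, |f i| ≤ C) :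
    ∃ A : H →L[ℝ] H, IsDiag e f A := by
  classical
  refine ⟨(e.repr.symm : lp (fun _ : ι => ℝ) 2 →L[ℝ] H) ∘L lpMulCLM f hf ∘L
    (e.repr : H →L[ℝ] lp (fun _ : ι => ℝ) 2), fun i => ?_⟩
  have hrepr : lpMulCLM f hf (e.repr (e i)) = f i • e.repr (e i) := by
    refine lp.ext (funext fun j => ?_)
    change f j * e.repr (e i) j = f i * e.repr (e i) j
    rcases eq_or_ne j i with rfl | h
    · rfl
    · simp [e.repr_self, h]
  change e.repr.symm (lpMulCLM f hf (e.repr (e i))) = _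
  rw [hrepr, map_smul, LinearIsometryEquiv.symm_apply_apply]

/-- The diagonal operator with eigenvalues `f`; by convention it is zero if `f` is unbounded, so
that it is used through `isDiag_diagOp`. -/
def diagOp (e : HilbertBasis ι ℝ H) (f : ι → ℝ) : H →L[ℝ] H :=
  open scoped Classical in if h : ∃ A, IsDiag e f A then h.choose else 0

theorem isDiag_diagOp (e : HilbertBasis ι ℝ H) {f : ι → ℝ} {C : ℝ} (hf : ∀ i, |f i| ≤ C) :
    IsDiag e f (diagOp e f) := by
  have h := exists_isDiag e hf
  rw [diagOp, dif_pos h]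
  exact h.choose_spec

theorem exists_hilbertBasis_of_orthogonalFamily [CompleteSpace H] {V : κ → Submodule ℝ H}
    [∀ k, CompleteSpace (V k)] (hV : OrthogonalFamily ℝ (fun k => V k) fun k => (V k).subtypeₗᵢ)
    (htotal : (⨆ k, V k)ᗮ = ⊥) :
    ∃ e : HilbertBasis (Σ k, basisIndex (V k)) ℝ H, ∀ i, e i ∈ V i.1 := by
  have hon := hV.orthonormal_sigma_orthonormal
    (v_family := fun k => (someBasis (V k) : basisIndex (V k) → V k))
    (fun k => (someBasis (V k)).orthonormal)
  refine ⟨.mkOfOrthogonalEqBot hon ?_, fun i => ?_⟩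
  · rw [eq_bot_iff, ← htotal]
    intro x hx
    rw [← Submodule.iInf_orthogonal, Submodule.mem_iInf]
    intro k
    rw [Submodule.mem_orthogonal']
    intro v hv
    have hzero : innerSL ℝ x ∘L (V k).subtypeL = 0 :=
      eq_of_apply_hilbertBasis_eq (someBasis (V k)) fun i =>
        (Submodule.mem_orthogonal' _ _).1 hx _ (Submodule.subset_span ⟨⟨k, i⟩, rfl⟩)
    exact DFunLike.congr_fun hzero ⟨v, hv⟩
  · rw [HilbertBasis.coe_mkOfOrthogonalEqBot]
    exact Subtype.property _

theorem exists_hilbertBasis_isDiag.{u} {H : Type u} [NormedAddCommGroup H]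
    [InnerProductSpace ℝ H] [CompleteSpace H] {A : H →L[ℝ] H} (hc : IsCompactOperator A)
    (hs : A.IsSymmetric) :
    ∃ (ι : Type u) (e : HilbertBasis ι ℝ H) (a : ι → ℝ), IsDiag e a A := by
  let V := Module.End.eigenspace (A : Module.End ℝ H)
  have hclosed : ∀ μ, IsClosed (V μ : Set H) := fun μ => by
    have hV : (V μ : Set H) = {x | A x = μ • x} := by
      ext x
      exact Module.End.mem_eigenspace_iff
    rw [hV]
    exact isClosed_eq A.continuous (continuous_const_smul μ)
  have : ∀ μ, CompleteSpace (V μ) := fun μ => (hclosed μ).completeSpace_coe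
  obtain ⟨e, he⟩ := exists_hilbertBasis_of_orthogonalFamily hs.orthogonalFamily_eigenspaces
    (ContinuousLinearMap.orthogonalComplement_iSup_eigenspaces_eq_bot hc hs)
  exact ⟨_, e, fun i => i.1, fun i => Module.End.mem_eigenspace_iff.1 (he i)⟩

theorem IsDiag.eigenProj_apply_basis [CompleteSpace H] {e : HilbertBasis ι ℝ H} {a : ι → ℝ}
    {A : H →L[ℝ] H} (hA : IsDiag e a A) (μ : ℝ) (i : ι) [Decidable (a i = μ)] :
    eigenProj A μ (e i) = if a i = μ then e i else 0 := by
  split_ifs with hi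
  · exact eigenProj_of_eigenvector (by rw [hA i, hi])
  · exact eigenProj_of_eigenvector_ne hA.isSymmetric (Ne.symm hi) (hA i)

theorem IsDiag.specFun_apply [CompleteSpace H] {e : HilbertBasis ι ℝ H} {a : ι → ℝ}
    {A G : H →L[ℝ] H} (hA : IsDiag e a A) (g : ℝ → ℝ) (hG : IsDiag e (fun i => g (a i)) G) (h : H) :
    specFun g A h = G h := by
  classical
  have hsum : HasSum (fun i => e.repr h i • g (a i) • e i) (G h) := by
    simpa only [map_smul, hG _] using (e.hasSum_repr h).mapL G
  rw [← (Equiv.sigmaFiberEquiv a).hasSum_iff] at hsum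
  refine (hsum.sigma fun μ => ?_).tsum_eq
  have hproj : HasSum (fun i => g μ • e.repr h i • eigenProj A μ (e i))
      (g μ • eigenProj A μ h) := by
    simpa only [map_smul] using ((e.hasSum_repr h).mapL (eigenProj A μ)).const_smul (g μ)
  have hfiber : Function.support (fun i => g μ • e.repr h i • eigenProj A μ (e i)) ⊆
      {i | a i = μ} := fun i hi => by
    by_contra hne
    simp [hA.eigenProj_apply_basis, show a i ≠ μ from hne] at hi
  have hterm : ((fun i => g μ • e.repr h i • eigenProj A μ (e i)) ∘ (↑) : {i | a i = μ} → H) =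
      fun i => ((fun i => e.repr h i • g (a i) • e i) ∘ Equiv.sigmaFiberEquiv a) ⟨μ, i⟩ := by
    funext i
    have hi : a i.1 = μ := i.2
    simp [Equiv.sigmaFiberEquiv, hA.eigenProj_apply_basis, hi, smul_comm (g μ)]
  exact hterm ▸ (hasSum_subtype_iff_of_support_subset hfiber).2 hproj

end Diagonal

/-! ### The Heinz inequality -/

section Heinz

variable {ι κ H : Type*} [NormedAddCommGroup H] [InnerProductSpace ℝ H]

theorem parallelSum_mul_sq_le (a s x y : ℝ) (hs : 0 < s) :
    a ^ 2 * s / (a ^ 2 + s) * x ^ 2 ≤ a ^ 2 * (x - y) ^ 2 + s * y ^ 2 := by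
  rw [div_mul_eq_mul_div, div_le_iff₀ (by positivity)]
  nlinarith [sq_nonneg (a ^ 2 * (x - y) - s * y)]

/-- The quadratic form `∑ᵢ aᵢ² s / (aᵢ² + s) ⟨eᵢ, x⟩²` of the parallel sum of `A²` and `s`, for the
diagonal operator `A` with eigenvalues `aᵢ`. It is the minimum over `y` of
`‖A (x - y)‖² + s ‖y‖²`, and hence monotone in the form `‖A x‖²`. -/
def parallelForm (e : HilbertBasis ι ℝ H) (a : ι → ℝ) (s : ℝ) (x : H) : ℝ≥0∞ :=
  ∑' i, ENNReal.ofReal (a i ^ 2 * s / (a i ^ 2 + s) * ⟪e i, x⟫_ℝ ^ 2)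

section ParallelForm

variable {e : HilbertBasis ι ℝ H} {a : ι → ℝ} {A : H →L[ℝ] H}

theorem IsDiag.hasSum_norm_sub_sq_add (hA : IsDiag e a A) (s : ℝ) (x y : H) :
    HasSum (fun i => a i ^ 2 * (⟪e i, x⟫_ℝ - ⟪e i, y⟫_ℝ) ^ 2 + s * ⟪e i, y⟫_ℝ ^ 2)
      (‖A (x - y)‖ ^ 2 + s * ‖y‖ ^ 2) := by
  simpa only [inner_sub_right] using
    (hA.hasSum_norm_sq (x - y)).add ((hasSum_inner_sq e y).mul_left s)

theorem IsDiag.parallelForm_le (hA : IsDiag e a A) {s : ℝ} (hs : 0 < s) (x y : H) :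
    parallelForm e a s x ≤ ENNReal.ofReal (‖A (x - y)‖ ^ 2 + s * ‖y‖ ^ 2) := by
  have h := hA.hasSum_norm_sub_sq_add s x y
  rw [parallelForm, ← h.tsum_eq, ENNReal.ofReal_tsum_of_nonneg (fun i => by positivity) h.summable]
  exact ENNReal.tsum_le_tsum fun i =>
    ENNReal.ofReal_le_ofReal (parallelSum_mul_sq_le _ _ _ _ hs)

theorem IsDiag.exists_parallelForm_eq (hA : IsDiag e a A) {s : ℝ} (hs : 0 < s) (x : H) :
    ∃ y, parallelForm e a s x = ENNReal.ofReal (‖A (x - y)‖ ^ 2 + s * ‖y‖ ^ 2) := by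
  obtain ⟨D, hD⟩ := exists_isDiag e (f := fun i => a i ^ 2 / (a i ^ 2 + s)) (C := 1) fun i => by
    rw [abs_of_nonneg (by positivity), div_le_one (by positivity)]
    linarith
  refine ⟨D x, ?_⟩
  have h := hA.hasSum_norm_sub_sq_add s x (D x)
  rw [parallelForm, ← h.tsum_eq, ENNReal.ofReal_tsum_of_nonneg (fun i => by positivity) h.summable]
  refine tsum_congr fun i => congrArg ENNReal.ofReal ?_
  rw [hD.inner_apply]
  have : a i ^ 2 + s ≠ 0 := by positivity
  field_simp
  ring

end ParallelForm

/-- The constant `∫ s ^ (θ - 1) / (1 + s) ds`, over `s > 0`, of the integral representation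
`∫ s ^ (θ - 1) (a² / (a² + s)) ds = heinzConst θ * a ^ (2 θ)`, written in the variable
`τ = log s`. -/
def heinzConst (θ : ℝ) : ℝ≥0∞ :=
  ∫⁻ τ : ℝ, ENNReal.ofReal (Real.exp (θ * τ) / (1 + Real.exp τ))

theorem heinzConst_ne_zero (θ : ℝ) : heinzConst θ ≠ 0 := by
  rw [heinzConst, Ne, lintegral_eq_zero_iff (by fun_prop)]
  intro hzero
  obtain ⟨τ, hτ⟩ := hzero.exists
  exact (ENNReal.ofReal_pos.2 (by positivity)).ne' hτ

theorem heinzConst_ne_top {θ : ℝ} (h0 : 0 < θ) (h1 : θ < 1) : heinzConst θ ≠ ∞ := by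
  have hm : Measurable fun τ : ℝ => Real.exp (θ * τ) / (1 + Real.exp τ) := by fun_prop
  have hneg : IntegrableOn (fun τ : ℝ => Real.exp (θ * τ) / (1 + Real.exp τ)) (Set.Iic 0) := by
    refine (integrableOn_exp_mul_Iic h0 0).mono' hm.aestronglyMeasurable (.of_forall fun τ => ?_)
    rw [Real.norm_of_nonneg (by positivity)]
    exact div_le_self (by positivity) (by linarith [Real.exp_pos τ])
  have hpos : IntegrableOn (fun τ : ℝ => Real.exp (θ * τ) / (1 + Real.exp τ)) (Set.Ioi 0) := by
    refine (integrableOn_exp_mul_Ioi (show θ - 1 < 0 by linarith) 0).mono'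
      hm.aestronglyMeasurable (.of_forall fun τ => ?_)
    rw [Real.norm_of_nonneg (by positivity), sub_mul, one_mul, Real.exp_sub]
    gcongr
    linarith
  have h := hneg.union hpos
  rw [Set.Iic_union_Ioi, integrableOn_univ] at h
  exact h.lintegral_lt_top.ne

theorem lintegral_exp_mul_parallelSum {θ a c : ℝ} (ha : 0 < a) (hc : 0 ≤ c) :
    ∫⁻ τ : ℝ, ENNReal.ofReal (Real.exp ((θ - 1) * τ)) *
        ENNReal.ofReal (a ^ 2 * Real.exp τ / (a ^ 2 + Real.exp τ) * c) =
      ENNReal.ofReal ((a ^ θ) ^ 2 * c) * heinzConst θ := by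
  rw [← lintegral_add_right_eq_self _ (2 * Real.log a), heinzConst,
    ← lintegral_const_mul _ (by fun_prop)]
  refine lintegral_congr fun τ => ?_
  rw [← ENNReal.ofReal_mul (by positivity), ← ENNReal.ofReal_mul (by positivity)]
  congr 1
  have hexp : Real.exp (2 * Real.log a) = a ^ 2 := by
    rw [mul_comm, Real.exp_mul, Real.exp_log ha, Real.rpow_two]
  have hpow : (a ^ θ) ^ 2 = Real.exp (θ * (2 * Real.log a)) := by
    rw [Real.rpow_def_of_pos ha, ← Real.exp_nat_mul]
    congr 1
    push_cast
    ring
  rw [Real.exp_add, hexp, hpow, sub_mul, one_mul, Real.exp_sub, Real.exp_add, hexp, mul_add,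
    Real.exp_add]
  have := Real.exp_pos τ
  field_simp

theorem IsDiag.lintegral_parallelForm [Countable ι] {e : HilbertBasis ι ℝ H} {a : ι → ℝ} {θ : ℝ}
    {A' : H →L[ℝ] H} (ha : ∀ i, 0 < a i) (hA' : IsDiag e (fun i => a i ^ θ) A') (x : H) :
    ∫⁻ τ : ℝ, ENNReal.ofReal (Real.exp ((θ - 1) * τ)) * parallelForm e a (Real.exp τ) x =
      ENNReal.ofReal (‖A' x‖ ^ 2) * heinzConst θ := by
  have hs := hA'.hasSum_norm_sq x
  simp only [parallelForm, ← ENNReal.tsum_mul_left]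
  rw [lintegral_tsum fun i => by fun_prop, ← hs.tsum_eq,
    ENNReal.ofReal_tsum_of_nonneg (fun i => by positivity) hs.summable, ← ENNReal.tsum_mul_right]
  exact tsum_congr fun i => lintegral_exp_mul_parallelSum (ha i) (sq_nonneg _)

section Inequality

variable [Countable ι] [Countable κ] {e : HilbertBasis ι ℝ H} {e' : HilbertBasis κ ℝ H}
  {a : ι → ℝ} {b : κ → ℝ} {A B A' B' : H →L[ℝ] H}

theorem heinz_of_norm_apply_le (hA : IsDiag e a A) (hB : IsDiag e' b B) (ha : ∀ i, 0 < a i)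
    (hb : ∀ i, 0 < b i) (h : ∀ x, ‖A x‖ ≤ ‖B x‖) {θ : ℝ} (h0 : 0 < θ) (h1 : θ < 1)
    (hA' : IsDiag e (fun i => a i ^ θ) A') (hB' : IsDiag e' (fun i => b i ^ θ) B') (x : H) :
    ‖A' x‖ ≤ ‖B' x‖ := by
  have hform : ∀ s, 0 < s → parallelForm e a s x ≤ parallelForm e' b s x := fun s hs => by
    obtain ⟨y, hy⟩ := hB.exists_parallelForm_eq hs x
    rw [hy]
    refine (hA.parallelForm_le hs x y).trans (ENNReal.ofReal_le_ofReal ?_)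
    have := h (x - y)
    gcongr
  have hle := lintegral_mono (μ := volume) fun τ : ℝ =>
    mul_le_mul_right (hform (Real.exp τ) (Real.exp_pos τ)) (.ofReal (Real.exp ((θ - 1) * τ)))
  rw [hA'.lintegral_parallelForm ha, hB'.lintegral_parallelForm hb,
    ENNReal.mul_le_mul_iff_left (heinzConst_ne_zero θ) (heinzConst_ne_top h0 h1),
    ENNReal.ofReal_le_ofReal_iff (sq_nonneg _)] at hle
  exact (sq_le_sq₀ (norm_nonneg _) (norm_nonneg _)).1 hle

theorem heinz (hA : IsDiag e a A) (hB : IsDiag e' b B) (ha : ∀ i, 0 < a i) (hb : ∀ i, 0 < b i)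
    {k : ℝ} (hk : 0 < k) (h : ∀ x, ‖A x‖ ≤ k * ‖B x‖) {θ : ℝ} (h0 : 0 ≤ θ) (h1 : θ ≤ 1)
    (hA' : IsDiag e (fun i => a i ^ θ) A') (hB' : IsDiag e' (fun i => b i ^ θ) B') (x : H) :
    ‖A' x‖ ≤ k ^ θ * ‖B' x‖ := by
  rcases h0.eq_or_lt with rfl | h0
  · simp only [Real.rpow_zero] at hA' hB' ⊢
    rw [hA'.unique IsDiag.one, hB'.unique IsDiag.one, one_mul]
  rcases h1.eq_or_lt with rfl | h1
  · simp only [Real.rpow_one] at hA' hB' ⊢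
    rw [hA'.unique hA, hB'.unique hB]
    exact h x
  have hkB' : IsDiag e' (fun i => (k * b i) ^ θ) (k ^ θ • B') :=
    (hB'.smul (k ^ θ)).congr fun i => (Real.mul_rpow hk.le (hb i).le).symm
  have hscaled := heinz_of_norm_apply_le hA (hB.smul k) ha (fun i => mul_pos hk (hb i))
    (fun x => by simpa [norm_smul, abs_of_pos hk] using h x) h0 h1 hA' hkB' x
  simpa [norm_smul, abs_of_nonneg (Real.rpow_nonneg hk.le θ)] using hscaled

end Inequality

end Heinz

/-! ### Hilbert-Schmidt norms -/

section HilbertSchmidt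

variable {ι H Y : Type*} [NormedAddCommGroup H] [InnerProductSpace ℝ H]
  [NormedAddCommGroup Y] [InnerProductSpace ℝ Y]

section ENorm

variable [CompleteSpace H]

/-- The Hilbert-Schmidt norm as an extended nonnegative real; it is `∞` exactly when the operator
is not Hilbert-Schmidt, so that estimates need no summability hypotheses. -/
def hsENorm (T : H →L[ℝ] Y) : ℝ≥0∞ :=
  hsNormSq T ^ (1 / 2 : ℝ)

theorem hsENorm_sq (T : H →L[ℝ] Y) : hsENorm T ^ 2 = hsNormSq T := by
  rw [hsENorm, ← ENNReal.rpow_mul_natCast]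
  norm_num

theorem hsENorm_zero : hsENorm (0 : H →L[ℝ] Y) = 0 := by
  simp [hsENorm, hsNormSq]

theorem hsENorm_neg (T : H →L[ℝ] Y) : hsENorm (-T) = hsENorm T := by
  simp [hsENorm, hsNormSq]

theorem hsENorm_add_le (S T : H →L[ℝ] Y) : hsENorm (S + T) ≤ hsENorm S + hsENorm T := by
  let _ : MeasurableSpace (basisIndex H) := ⊤
  have minkowski := ENNReal.lintegral_Lp_add_le (μ := Measure.count) (p := 2)
    (f := fun i => ‖S (someBasis H i)‖ₑ) (g := fun i => ‖T (someBasis H i)‖ₑ)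
    measurable_from_top.aemeasurable measurable_from_top.aemeasurable one_le_two
  simp only [lintegral_count, ENNReal.rpow_two] at minkowski
  refine le_trans ?_ minkowski
  rw [hsENorm, hsNormSq]
  gcongr
  exact enorm_add_le _ _

theorem hsENorm_sub_le (S T : H →L[ℝ] Y) : hsENorm (S - T) ≤ hsENorm S + hsENorm T := by
  rw [sub_eq_add_neg, ← hsENorm_neg T]
  exact hsENorm_add_le _ _

theorem hsENorm_sum_le (s : Finset ι) (T : ι → H →L[ℝ] Y) :
    hsENorm (∑ i ∈ s, T i) ≤ ∑ i ∈ s, hsENorm (T i) :=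
  Finset.le_sum_of_subadditive _ hsENorm_zero.le hsENorm_add_le _ _

theorem hsENorm_eq_ofReal_hsNorm {T : H →L[ℝ] Y} (hT : IsHilbertSchmidt T) :
    hsENorm T = ENNReal.ofReal (hsNorm T) := by
  rw [hsENorm, hsNorm, Real.sqrt_eq_rpow, ← ENNReal.ofReal_rpow_of_nonneg ENNReal.toReal_nonneg
    (by norm_num), ENNReal.ofReal_toReal hT]

variable [CompleteSpace Y]

theorem hsENorm_comp_le (T : H →L[ℝ] Y) (A : H →L[ℝ] H) :
    hsENorm (T ∘L A) ≤ hsENorm T * ‖A‖ₑ := by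
  rw [← ENNReal.pow_le_pow_left_iff two_ne_zero, mul_pow, hsENorm_sq, hsENorm_sq, hsNormSq,
    tsum_enorm_sq_eq_adjoint _ (someBasis Y), hsNormSq, tsum_enorm_sq_eq_adjoint _ (someBasis Y),
    ← ENNReal.tsum_mul_right]
  refine ENNReal.tsum_le_tsum fun i => ?_
  have hA : ‖A.adjoint‖ₑ = ‖A‖ₑ := by
    rw [← ofReal_norm, LinearIsometryEquiv.norm_map, ofReal_norm]
  rw [ContinuousLinearMap.adjoint_comp, ← mul_pow, mul_comm, ← hA]
  gcongr
  exact A.adjoint.le_opENorm _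

theorem hsENorm_comp_le_ofReal {T : H →L[ℝ] Y} {A : H →L[ℝ] H} {c d : ℝ}
    (hc : 0 ≤ c) (hT : hsENorm T ≤ ENNReal.ofReal c) (hA : ‖A‖ ≤ d) :
    hsENorm (T ∘L A) ≤ ENNReal.ofReal (c * d) := by
  rw [ENNReal.ofReal_mul hc]
  refine (hsENorm_comp_le T A).trans (mul_le_mul' hT ?_)
  rw [← ofReal_norm]
  exact ENNReal.ofReal_le_ofReal hA

theorem enorm_apply_le_hsENorm (T : H →L[ℝ] Y) (x : H) : ‖T x‖ₑ ≤ hsENorm T * ‖x‖ₑ := by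
  rw [← ENNReal.pow_le_pow_left_iff two_ne_zero, mul_pow, hsENorm_sq, hsNormSq,
    tsum_enorm_sq_eq_adjoint _ (someBasis Y), ← tsum_enorm_inner_sq (someBasis Y),
    ← ENNReal.tsum_mul_right]
  refine ENNReal.tsum_le_tsum fun i => ?_
  rw [← mul_pow, ← ContinuousLinearMap.adjoint_inner_right, mul_comm]
  gcongr
  simpa only [enorm_eq_nnnorm, ← ENNReal.coe_mul, ENNReal.coe_le_coe] using
    nnnorm_inner_le_nnnorm (𝕜 := ℝ) x (T.adjoint (someBasis Y i))

theorem opNorm_le_of_hsENorm_le {T : H →L[ℝ] Y} {c : ℝ} (hc : 0 ≤ c)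
    (hT : hsENorm T ≤ ENNReal.ofReal c) : ‖T‖ ≤ c := by
  refine T.opNorm_le_bound hc fun x => ?_
  have h := (enorm_apply_le_hsENorm T x).trans (mul_le_mul_left hT _)
  rwa [← ofReal_norm, ← ofReal_norm, ← ENNReal.ofReal_mul hc,
    ENNReal.ofReal_le_ofReal_iff (by positivity)] at h

theorem hsENorm_eq_ofReal_norm_lp (e : HilbertBasis ι ℝ H) {T : H →L[ℝ] Y}
    {w : lp (fun _ : ι => Y) 2} (h : ∀ i, T (e i) = w i) : hsENorm T = ENNReal.ofReal ‖w‖ := by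
  have hw := lp.hasSum_norm (p := 2) (by norm_num) w
  simp only [ENNReal.toReal_ofNat, Real.rpow_two] at hw
  rw [← (ENNReal.pow_right_strictMono two_ne_zero).injective.eq_iff, hsENorm_sq, hsNormSq_eq e,
    ← ENNReal.ofReal_pow (norm_nonneg _), ← hw.tsum_eq,
    ENNReal.ofReal_tsum_of_nonneg (fun _ => sq_nonneg _) hw.summable]
  exact tsum_congr fun i => by rw [h, ENNReal.ofReal_pow (norm_nonneg _), ofReal_norm]

end ENorm

section Tensor

theorem memℓp_tensor (e : HilbertBasis ι ℝ H) (v : Y) (u : H) :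
    Memℓp (fun i => ⟪e i, u⟫_ℝ • v) 2 := by
  refine memℓp_gen ?_
  simp only [norm_smul, ENNReal.toReal_ofNat, Real.rpow_two, mul_pow, Real.norm_eq_abs, sq_abs]
  exact (hasSum_inner_sq e u).summable.mul_right _

theorem norm_tensor (e : HilbertBasis ι ℝ H) (v : Y) (u : H) :
    ‖(⟨_, memℓp_tensor e v u⟩ : lp (fun _ : ι => Y) 2)‖ = ‖v‖ * ‖u‖ := by
  rw [← sq_eq_sq₀ (norm_nonneg _) (by positivity)]
  have h := lp.hasSum_norm (p := 2) (by norm_num)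
    (⟨_, memℓp_tensor e v u⟩ : lp (fun _ : ι => Y) 2)
  simp only [ENNReal.toReal_ofNat, Real.rpow_two, norm_smul, mul_pow, Real.norm_eq_abs,
    sq_abs] at h
  rw [h.unique ((hasSum_inner_sq e u).mul_right (‖v‖ ^ 2))]
  ring

/-- The rank one operator `v ⊗ u` as an element of the Hilbert space `ℓ²(ι, Y)`, which is
`S₂(H, Y)` written in the Hilbert basis `e`. Mathlib has no Hilbert space of Hilbert-Schmidt
operators in which probabilistic inequalities could be applied directly. -/
def hsTensor (e : HilbertBasis ι ℝ H) : Y →L[ℝ] H →L[ℝ] lp (fun _ : ι => Y) 2 :=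
  LinearMap.mkContinuous₂
    (LinearMap.mk₂ ℝ (fun v u => (⟨_, memℓp_tensor e v u⟩ : lp (fun _ : ι => Y) 2))
      (fun _ _ _ => lp.ext (funext fun _ => smul_add _ _ _))
      (fun _ _ _ => lp.ext (funext fun _ => smul_comm _ _ _))
      (fun _ _ _ => lp.ext (funext fun _ => by
        simp only [lp.coeFn_add, Pi.add_apply, inner_add_right, add_smul]))
      (fun _ _ _ => lp.ext (funext fun _ => by
        simp only [lp.coeFn_smul, Pi.smul_apply, real_inner_smul_right, mul_smul])))
    1 fun v u => (norm_tensor e v u).le.trans_eq (by ring)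

theorem hsTensor_apply (e : HilbertBasis ι ℝ H) (v : Y) (u : H) (i : ι) :
    hsTensor e v u i = ⟪e i, u⟫_ℝ • v :=
  rfl

theorem norm_hsTensor (e : HilbertBasis ι ℝ H) (v : Y) (u : H) :
    ‖hsTensor e v u‖ = ‖v‖ * ‖u‖ :=
  norm_tensor e v u

end Tensor

end HilbertSchmidt

/-! ### Concentration in Hilbert spaces -/

section CoshNorm

variable {G : Type*} [NormedAddCommGroup G] [InnerProductSpace ℝ G]

theorem convexOn_cosh_sqrt : ConvexOn ℝ (Set.Ici 0) fun x => Real.cosh (√x) := by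
  refine ⟨convex_Ici 0, fun x hx y hy a b ha hb hab => ?_⟩
  have hseries : ∀ z ∈ Set.Ici (0 : ℝ), HasSum (fun n : ℕ => z ^ n / ((2 * n).factorial : ℝ))
      (Real.cosh (√z)) := fun z hz => by
    simpa only [pow_mul, Real.sq_sqrt (Set.mem_Ici.1 hz)] using Real.hasSum_cosh (√z)
  refine hasSum_le (fun n => ?_) (hseries _ (convex_Ici 0 hx hy ha hb hab))
    (((hseries x hx).mul_left a).add ((hseries y hy).mul_left b))
  have hpow := (convexOn_pow n).2 hx hy ha hb hab
  simp only [smul_eq_mul] at hpow ⊢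
  calc _ ≤ (a * x ^ n + b * y ^ n) / ((2 * n).factorial : ℝ) := by gcongr
    _ = _ := by ring

/- `‖v + ξ‖²` is the convex combination of `(‖v‖ - ‖ξ‖)²` and `(‖v‖ + ‖ξ‖)²` with weights
`(1 ∓ r) / 2`, where `r` is the cosine of the angle between `v` and `ξ`. -/
theorem cosh_norm_add_le_of_ne_zero {v ξ : G} (hv : v ≠ 0) (hξ : ξ ≠ 0) :
    Real.cosh ‖v + ξ‖ ≤ Real.cosh ‖v‖ * Real.cosh ‖ξ‖ +
      ⟪v, ξ⟫_ℝ / (‖v‖ * ‖ξ‖) * (Real.sinh ‖v‖ * Real.sinh ‖ξ‖) := by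
  have hr := abs_le.1 (abs_real_inner_div_norm_mul_norm_le_one v ξ)
  set r := ⟪v, ξ⟫_ℝ / (‖v‖ * ‖ξ‖)
  have hinner : ⟪v, ξ⟫_ℝ = r * (‖v‖ * ‖ξ‖) :=
    (div_mul_cancel₀ _ (mul_ne_zero (norm_ne_zero_iff.2 hv) (norm_ne_zero_iff.2 hξ))).symm
  have hconv := convexOn_cosh_sqrt.2 (Set.mem_Ici.2 (sq_nonneg (‖v‖ - ‖ξ‖)))
    (Set.mem_Ici.2 (sq_nonneg (‖v‖ + ‖ξ‖))) (show 0 ≤ (1 - r) / 2 by linarith)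
    (show 0 ≤ (1 + r) / 2 by linarith) (by ring)
  have hcomb : (1 - r) / 2 * (‖v‖ - ‖ξ‖) ^ 2 + (1 + r) / 2 * (‖v‖ + ‖ξ‖) ^ 2 = ‖v + ξ‖ ^ 2 := by
    rw [norm_add_sq_real, hinner]
    ring
  simp only [smul_eq_mul] at hconv
  rw [hcomb, Real.sqrt_sq (norm_nonneg _), Real.sqrt_sq_eq_abs, Real.sqrt_sq_eq_abs,
    Real.cosh_abs, Real.cosh_abs, Real.cosh_sub, Real.cosh_add] at hconv
  linarith

theorem cosh_norm_add_le (v ξ : G) (hξ : ‖ξ‖ ≤ 1) :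
    Real.cosh ‖v + ξ‖ ≤ Real.cosh ‖v‖ * (1 + ‖ξ‖ ^ 2) + Real.sinh ‖v‖ / ‖v‖ * ⟪v, ξ⟫_ℝ := by
  rcases eq_or_ne ξ 0 with rfl | hξ0
  · simp
  have hsinh : ‖ξ‖ ≤ Real.sinh ‖ξ‖ := Real.self_le_sinh_iff.2 (norm_nonneg ξ)
  have hexp : Real.cosh ‖ξ‖ + Real.sinh ‖ξ‖ - 1 - ‖ξ‖ ≤ ‖ξ‖ ^ 2 := by
    rw [Real.cosh_add_sinh]
    exact (le_abs_self _).trans (Real.abs_exp_sub_one_sub_id_le (by rwa [abs_norm]))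
  rcases eq_or_ne v 0 with rfl | hv0
  · simp only [zero_add, norm_zero, Real.cosh_zero, one_mul, inner_zero_left, mul_zero, add_zero]
    linarith
  have hξ_ne := norm_ne_zero_iff.2 hξ0
  have hr := (abs_le.1 (abs_real_inner_div_norm_mul_norm_le_one v ξ)).2
  refine (cosh_norm_add_le_of_ne_zero hv0 hξ0).trans ?_
  rw [show Real.sinh ‖v‖ / ‖v‖ * ⟪v, ξ⟫_ℝ =
    ⟪v, ξ⟫_ℝ / (‖v‖ * ‖ξ‖) * (Real.sinh ‖v‖ * ‖ξ‖) by field_simp]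
  set r := ⟪v, ξ⟫_ℝ / (‖v‖ * ‖ξ‖)
  have hrv : r * Real.sinh ‖v‖ ≤ Real.cosh ‖v‖ := by
    nlinarith [Real.sinh_nonneg_iff.2 (norm_nonneg v), Real.sinh_lt_cosh ‖v‖]
  linarith [mul_le_mul_of_nonneg_right hrv (sub_nonneg.2 hsinh),
    mul_le_mul_of_nonneg_left hexp (Real.cosh_pos ‖v‖).le]

end CoshNorm

section PiSum

variable {Z G : Type*} [MeasurableSpace Z] [NormedAddCommGroup G] {μ : Measure Z}
  [IsProbabilityMeasure μ] {F : Z → G}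

theorem stronglyMeasurable_pi_sum (hF : StronglyMeasurable F) (n : ℕ) :
    StronglyMeasurable fun z : Fin n → Z => ∑ i, F (z i) :=
  Finset.stronglyMeasurable_fun_sum _ fun i _ => hF.comp_measurable (by fun_prop)

/- This is the supermartingale property of `Ψₙ₋ₖ (v + ∑_{i < k} F zᵢ)`, with the coordinates
integrated out one after the other. -/
theorem lintegral_pi_sum_le (hF : StronglyMeasurable F) (Ψ : ℕ → G → ℝ≥0∞)
    (hΨ : Continuous (Ψ 0)) (hstep : ∀ n v, ∫⁻ z, Ψ n (v + F z) ∂μ ≤ Ψ (n + 1) v) (n : ℕ)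
    (v : G) : ∫⁻ z, Ψ 0 (v + ∑ i, F (z i)) ∂(Measure.pi fun _ : Fin n => μ) ≤ Ψ n v := by
  induction n generalizing v with
  | zero => simp
  | succ n ih =>
    have hmp := (measurePreserving_piFinSuccAbove (fun _ : Fin (n + 1) => μ) 0).symm
    have hsum : ∀ p : Z × (Fin n → Z),
        v + ∑ i, F ((MeasurableEquiv.piFinSuccAbove (fun _ => Z) 0).symm p i) =
          (v + F p.1) + ∑ i, F (p.2 i) := fun p => by
      rw [Fin.sum_univ_succ, add_assoc]
      rfl
    have hm : StronglyMeasurable fun p : Z × (Fin n → Z) => (v + F p.1) + ∑ i, F (p.2 i) :=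
      (stronglyMeasurable_const.add (hF.comp_measurable measurable_fst)).add
        ((stronglyMeasurable_pi_sum hF n).comp_measurable measurable_snd)
    rw [← hmp.lintegral_comp_emb (MeasurableEquiv.measurableEmbedding _)]
    simp only [hsum]
    rw [lintegral_prod _ (hΨ.comp_stronglyMeasurable hm).measurable.aemeasurable]
    exact (lintegral_mono fun z => ih (v + F z)).trans (hstep n v)

omit [IsProbabilityMeasure μ] in
theorem measure_lt_norm_le_of_lintegral_le (hF : StronglyMeasurable F) {φ : ℝ → ℝ}
    (hφ : Continuous φ) (hmono : MonotoneOn φ (Set.Ici 0)) {c B : ℝ} (hc : 0 ≤ c)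
    (hφc : 0 < φ c) (hB : ∫⁻ z, ENNReal.ofReal (φ ‖F z‖) ∂μ ≤ ENNReal.ofReal B) :
    μ {z | c < ‖F z‖} ≤ ENNReal.ofReal (B / φ c) := by
  have hsub : {z | c < ‖F z‖} ⊆ {z | ENNReal.ofReal (φ c) ≤ ENNReal.ofReal (φ ‖F z‖)} :=
    fun z hz => ENNReal.ofReal_le_ofReal
      (hmono (Set.mem_Ici.2 hc) (Set.mem_Ici.2 (norm_nonneg _)) (le_of_lt hz))
  have hm : Measurable fun z => ENNReal.ofReal (φ ‖F z‖) :=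
    (hφ.measurable.comp hF.norm.measurable).ennreal_ofReal
  refine (measure_mono hsub).trans ((meas_ge_le_lintegral_div hm.aemeasurable
    (ENNReal.ofReal_pos.2 hφc).ne' ENNReal.ofReal_ne_top).trans ?_)
  rw [ENNReal.ofReal_div_of_pos hφc]
  gcongr

omit [IsProbabilityMeasure μ] in
theorem natCast_mul_integral_norm_sq_le {σ : ℝ} (hσ : ∫ z, ‖F z‖ ^ 2 ∂μ ≤ σ ^ 2) (n : ℕ) :
    n * ∫ z, ‖F z‖ ^ 2 ∂μ ≤ (σ * √n) ^ 2 := by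
  rw [mul_pow, Real.sq_sqrt (Nat.cast_nonneg n), mul_comm]
  gcongr

end PiSum

theorem norm_average_sub {Z G : Type*} [NormedAddCommGroup G] [NormedSpace ℝ G] (F : Z → G)
    (m : G) {n : ℕ} (hn : n ≠ 0) (z : Fin n → Z) :
    ‖(1 / n : ℝ) • ∑ i, F (z i) - m‖ = (1 / n : ℝ) * ‖∑ i, (F (z i) - m)‖ := by
  rw [← Real.norm_of_nonneg (show (0 : ℝ) ≤ 1 / n by positivity), ← norm_smul,
    Finset.sum_sub_distrib, smul_sub]
  simp [← Nat.cast_smul_eq_nsmul ℝ, smul_smul, hn]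

section Concentration

variable {Z G : Type*} [MeasurableSpace Z] [NormedAddCommGroup G] [InnerProductSpace ℝ G]
  [CompleteSpace G] {μ : Measure Z} [IsProbabilityMeasure μ] {F : Z → G}

theorem integral_norm_add_sq (hF : MemLp F 2 μ) (v : G) :
    ∫ z, ‖v + F z‖ ^ 2 ∂μ = ‖v‖ ^ 2 + 2 * ⟪v, ∫ z, F z ∂μ⟫_ℝ + ∫ z, ‖F z‖ ^ 2 ∂μ := by
  have hint := hF.integrable one_le_two
  have hsq := (memLp_two_iff_integrable_sq_norm hF.1).1 hF
  have hinner : Integrable (fun z => 2 * ⟪v, F z⟫_ℝ) μ := (hint.const_inner v).const_mul _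
  simp only [norm_add_sq_real]
  rw [integral_add ((integrable_const _).fun_add hinner) hsq,
    integral_add (integrable_const _) hinner, integral_const_mul, integral_inner hint,
    integral_const, probReal_univ, one_smul]

theorem integral_norm_sub_integral_sq_le (hF : MemLp F 2 μ) :
    ∫ z, ‖F z - ∫ z, F z ∂μ‖ ^ 2 ∂μ ≤ ∫ z, ‖F z‖ ^ 2 ∂μ := by
  have h := integral_norm_add_sq hF (-∫ z, F z ∂μ)
  simp only [neg_add_eq_sub, norm_neg, inner_neg_left, real_inner_self_eq_norm_sq] at h
  rw [h]
  nlinarith [sq_nonneg ‖∫ z, F z ∂μ‖]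

theorem lintegral_pi_norm_sum_sq_le (hF : StronglyMeasurable F) (h2 : MemLp F 2 μ)
    (h0 : ∫ z, F z ∂μ = 0) (n : ℕ) :
    ∫⁻ z, ENNReal.ofReal (‖∑ i, F (z i)‖ ^ 2) ∂(Measure.pi fun _ : Fin n => μ) ≤
      ENNReal.ofReal (n * ∫ z, ‖F z‖ ^ 2 ∂μ) := by
  set W := ∫ z, ‖F z‖ ^ 2 ∂μ
  have : 0 ≤ W := integral_nonneg fun z => sq_nonneg _
  have hstep (k : ℕ) (v : G) : ∫⁻ z, ENNReal.ofReal (‖v + F z‖ ^ 2 + k * W) ∂μ ≤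
      ENNReal.ofReal (‖v‖ ^ 2 + (k + 1 : ℕ) * W) := by
    have hint : Integrable (fun z => ‖v + F z‖ ^ 2) μ :=
      (memLp_two_iff_integrable_sq_norm ((memLp_const v).add h2).1).1 ((memLp_const v).add h2)
    rw [← ofReal_integral_eq_lintegral_ofReal (hint.fun_add (integrable_const _))
      (.of_forall fun z => show 0 ≤ ‖v + F z‖ ^ 2 + k * W by positivity),
      integral_add hint (integrable_const _), integral_norm_add_sq h2, h0, integral_const,
      probReal_univ, one_smul, inner_zero_right]
    refine ENNReal.ofReal_le_ofReal (le_of_eq ?_)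
    push_cast
    ring
  simpa using lintegral_pi_sum_le hF (fun k v => ENNReal.ofReal (‖v‖ ^ 2 + k * W))
    (ENNReal.continuous_ofReal.comp (by fun_prop)) hstep n 0

theorem lintegral_cosh_norm_add_le (hF : StronglyMeasurable F) (h1 : ∀ᵐ z ∂μ, ‖F z‖ ≤ 1)
    (h0 : ∫ z, F z ∂μ = 0) (v : G) :
    ∫⁻ z, ENNReal.ofReal (Real.cosh ‖v + F z‖) ∂μ ≤
      ENNReal.ofReal (Real.exp (∫ z, ‖F z‖ ^ 2 ∂μ) * Real.cosh ‖v‖) := by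
  have h2 : MemLp F 2 μ := .of_bound hF.aestronglyMeasurable 1 h1
  have hint := h2.integrable one_le_two
  have hsq := (memLp_two_iff_integrable_sq_norm h2.1).1 h2
  have hle : ∀ᵐ z ∂μ, Real.cosh ‖v + F z‖ ≤
      Real.cosh ‖v‖ * (1 + ‖F z‖ ^ 2) + Real.sinh ‖v‖ / ‖v‖ * ⟪v, F z⟫_ℝ :=
    h1.mono fun z hz => cosh_norm_add_le v _ hz
  have hint1 : Integrable (fun z => Real.cosh ‖v‖ * (1 + ‖F z‖ ^ 2)) μ :=
    ((integrable_const _).add hsq).const_mul _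
  have hint2 : Integrable (fun z => Real.sinh ‖v‖ / ‖v‖ * ⟪v, F z⟫_ℝ) μ :=
    (hint.const_inner v).const_mul _
  refine (lintegral_mono_ae (hle.mono fun z hz => ENNReal.ofReal_le_ofReal hz)).trans ?_
  rw [← ofReal_integral_eq_lintegral_ofReal (hint1.fun_add hint2)
    (hle.mono fun z hz => (Real.cosh_pos _).le.trans hz)]
  refine ENNReal.ofReal_le_ofReal ?_
  rw [integral_add hint1 hint2, integral_const_mul, integral_const_mul, integral_inner hint, h0,
    inner_zero_right, mul_zero, add_zero, integral_add (integrable_const _) hsq, integral_const,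
    probReal_univ, one_smul, mul_comm, add_comm]
  gcongr
  exact Real.add_one_le_exp _

theorem lintegral_pi_cosh_norm_sum_le (hF : StronglyMeasurable F) (h1 : ∀ᵐ z ∂μ, ‖F z‖ ≤ 1)
    (h0 : ∫ z, F z ∂μ = 0) (n : ℕ) :
    ∫⁻ z, ENNReal.ofReal (Real.cosh ‖∑ i, F (z i)‖) ∂(Measure.pi fun _ : Fin n => μ) ≤
      ENNReal.ofReal (Real.exp (n * ∫ z, ‖F z‖ ^ 2 ∂μ)) := by
  set W := ∫ z, ‖F z‖ ^ 2 ∂μ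
  have hstep (k : ℕ) (v : G) :
      ∫⁻ z, ENNReal.ofReal (Real.exp (k * W)) * ENNReal.ofReal (Real.cosh ‖v + F z‖) ∂μ ≤
        ENNReal.ofReal (Real.exp ((k + 1 : ℕ) * W)) * ENNReal.ofReal (Real.cosh ‖v‖) := by
    rw [lintegral_const_mul' _ _ ENNReal.ofReal_ne_top]
    refine (mul_le_mul_right (lintegral_cosh_norm_add_le hF h1 h0 v) _).trans_eq ?_
    rw [← ENNReal.ofReal_mul (Real.exp_nonneg _), ← ENNReal.ofReal_mul (Real.exp_nonneg _),
      ← mul_assoc, ← Real.exp_add]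
    refine congrArg (fun r => ENNReal.ofReal (Real.exp r * Real.cosh ‖v‖)) ?_
    push_cast
    ring
  have hcont : Continuous fun v : G =>
      ENNReal.ofReal (Real.exp ((0 : ℕ) * W)) * ENNReal.ofReal (Real.cosh ‖v‖) :=
    (ENNReal.continuous_const_mul ENNReal.ofReal_ne_top).comp
      (ENNReal.continuous_ofReal.comp (by fun_prop))
  simpa using lintegral_pi_sum_le hF
    (fun k v => ENNReal.ofReal (Real.exp (k * W)) * ENNReal.ofReal (Real.cosh ‖v‖)) hcont hstep n 0

theorem measure_pi_norm_sum_pos_eq_zero (hF : StronglyMeasurable F) (h2 : MemLp F 2 μ)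
    (h0 : ∫ z, F z ∂μ = 0) {σ : ℝ} (hW : ∫ z, ‖F z‖ ^ 2 ∂μ ≤ σ ^ 2) {n : ℕ} (hn : σ * √n = 0) :
    (Measure.pi fun _ : Fin n => μ) {z | 0 < ‖∑ i, F (z i)‖} = 0 := by
  have h := (lintegral_pi_norm_sum_sq_le hF h2 h0 n).trans
    (ENNReal.ofReal_le_ofReal (natCast_mul_integral_norm_sq_le hW n))
  rw [hn, zero_pow two_ne_zero, ENNReal.ofReal_zero, nonpos_iff_eq_zero, lintegral_eq_zero_iff
    ((stronglyMeasurable_pi_sum hF n).norm.measurable.pow_const 2).ennreal_ofReal] at h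
  refine measure_mono_null (fun z (hz : 0 < ‖∑ i, F (z i)‖) => ?_) (ae_iff.1 h)
  simpa using hz

theorem chebyshev_measure_pi_norm_sum (hF : StronglyMeasurable F) (h2 : MemLp F 2 μ)
    (h0 : ∫ z, F z ∂μ = 0) {σ : ℝ} (hσ : 0 ≤ σ) (hW : ∫ z, ‖F z‖ ^ 2 ∂μ ≤ σ ^ 2) (n : ℕ) {a : ℝ}
    (ha : 0 < a) :
    (Measure.pi fun _ : Fin n => μ) {z | a * (σ * √n) < ‖∑ i, F (z i)‖} ≤
      ENNReal.ofReal (1 / a ^ 2) := by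
  have hσn := mul_nonneg hσ (Real.sqrt_nonneg n)
  rcases hσn.eq_or_lt with hz | hpos
  · rw [← hz, mul_zero, measure_pi_norm_sum_pos_eq_zero hF h2 h0 hW hz.symm]
    exact zero_le
  have hB := (lintegral_pi_norm_sum_sq_le hF h2 h0 n).trans
    (ENNReal.ofReal_le_ofReal (natCast_mul_integral_norm_sq_le hW n))
  refine (measure_lt_norm_le_of_lintegral_le (stronglyMeasurable_pi_sum hF n) (continuous_pow 2)
    (fun x hx y _ hxy => pow_le_pow_left₀ hx hxy 2) (by positivity) (by positivity) hB).trans_eq ?_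
  rw [mul_pow a, div_mul_cancel_right₀ (by positivity), one_div]

theorem bernstein_measure_pi_norm_sum (hF : StronglyMeasurable F) {L : ℝ} (hL0 : 0 ≤ L)
    (hL : ∀ᵐ z ∂μ, ‖F z‖ ≤ L) (h0 : ∫ z, F z ∂μ = 0) {σ : ℝ} (hσ : 0 ≤ σ)
    (hW : ∫ z, ‖F z‖ ^ 2 ∂μ ≤ σ ^ 2) (n : ℕ) {t : ℝ} (ht : 0 ≤ t) :
    (Measure.pi fun _ : Fin n => μ) {z | t * (L + σ * √n) < ‖∑ i, F (z i)‖} ≤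
      ENNReal.ofReal (2 * Real.exp (1 - t)) := by
  have hσn := mul_nonneg hσ (Real.sqrt_nonneg n)
  rcases (add_nonneg hL0 hσn).eq_or_lt with hz | hpos
  · rw [← hz, mul_zero, measure_pi_norm_sum_pos_eq_zero hF
      (.of_bound hF.aestronglyMeasurable L hL) h0 hW (by linarith)]
    exact zero_le
  set s := (L + σ * √n)⁻¹
  have hs : 0 < s := inv_pos.2 hpos
  have hsL : s * (L + σ * √n) = 1 := inv_mul_cancel₀ hpos.ne'
  have hbound : ∀ᵐ z ∂μ, ‖s • F z‖ ≤ 1 := by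
    filter_upwards [hL] with z hz
    rw [norm_smul, Real.norm_of_nonneg hs.le]
    nlinarith
  have hvar : n * ∫ z, ‖s • F z‖ ^ 2 ∂μ ≤ 1 := by
    simp only [norm_smul, mul_pow, Real.norm_eq_abs, sq_abs]
    rw [integral_const_mul, mul_left_comm]
    calc s ^ 2 * (n * ∫ z, ‖F z‖ ^ 2 ∂μ) ≤ s ^ 2 * (σ * √n) ^ 2 := by
          gcongr
          exact natCast_mul_integral_norm_sq_le hW n
      _ = (s * (σ * √n)) ^ 2 := by ring
      _ ≤ 1 := pow_le_one₀ (by positivity) (by nlinarith)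
  have hB := (lintegral_pi_cosh_norm_sum_le (hF.const_smul s) hbound
    (by simp only [Pi.smul_apply, integral_smul, h0, smul_zero]) n).trans
      (ENNReal.ofReal_le_ofReal (Real.exp_le_exp.2 hvar))
  simp only [Pi.smul_apply, ← Finset.smul_sum] at hB
  have hset : {z : Fin n → Z | t * (L + σ * √n) < ‖∑ i, F (z i)‖} =
      {z | t < ‖s • ∑ i, F (z i)‖} := by
    ext z
    rw [Set.mem_ofPred_eq, Set.mem_ofPred_eq, norm_smul, Real.norm_of_nonneg hs.le,
      ← mul_lt_mul_iff_right₀ hs, mul_left_comm, hsL, mul_one]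
  rw [hset]
  refine (measure_lt_norm_le_of_lintegral_le ((stronglyMeasurable_pi_sum hF n).const_smul s)
    Real.continuous_cosh Real.cosh_strictMonoOn.monotoneOn ht (Real.cosh_pos t) hB).trans
      (ENNReal.ofReal_le_ofReal ?_)
  rw [div_le_iff₀ (Real.cosh_pos t), Real.cosh_eq, Real.exp_sub]
  have := Real.exp_pos 1
  field_simp
  linarith [Real.exp_pos (-t)]

theorem measure_pi_norm_average_sub_integral (hF : StronglyMeasurable F) {L : ℝ} (hL0 : 0 ≤ L)
    (hL : ∀ᵐ z ∂μ, ‖F z‖ ≤ L) {σ : ℝ} (hσ : 0 ≤ σ) (hW : ∫ z, ‖F z‖ ^ 2 ∂μ ≤ σ ^ 2) {n : ℕ}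
    (hn : n ≠ 0) {a t : ℝ} (ha : 2 ≤ a) (ht : 0 < t) :
    (Measure.pi fun _ : Fin n => μ)
        {z | a * (2 * L / n + σ / √n) * t < ‖(1 / n : ℝ) • ∑ i, F (z i) - ∫ z, F z ∂μ‖} ≤
      ENNReal.ofReal (min (2 * Real.exp (1 - 2 * t)) (1 / (a * t) ^ 2)) := by
  have h2 : MemLp F 2 μ := .of_bound hF.aestronglyMeasurable L hL
  set m := ∫ z, F z ∂μ with m_def
  have hm : ‖m‖ ≤ L := by simpa using norm_integral_le_of_norm_le_const hL
  have hFc : StronglyMeasurable fun z => F z - m := hF.sub stronglyMeasurable_const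
  have hLc : ∀ᵐ z ∂μ, ‖F z - m‖ ≤ 2 * L := hL.mono fun z hz => by
    linarith [norm_sub_le (F z) m]
  have h0c : ∫ z, (F z - m) ∂μ = 0 := by
    rw [integral_sub (h2.integrable one_le_two) (integrable_const _), integral_const,
      probReal_univ, one_smul, m_def, sub_self]
  have hWc := (integral_norm_sub_integral_sq_le h2).trans hW
  have hn0 : (0 : ℝ) < n := by positivity
  have hscale : n * (a * (2 * L / n + σ / √n) * t) = a * t * (2 * L + σ * √n) := by
    have hs : √(n : ℝ) ^ 2 = n := Real.sq_sqrt hn0.le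
    field_simp
    linear_combination (-σ) * hs
  have hset : {z : Fin n → Z | a * (2 * L / n + σ / √n) * t <
      ‖(1 / n : ℝ) • ∑ i, F (z i) - m‖} = {z | a * t * (2 * L + σ * √n) <
        ‖∑ i, (F (z i) - m)‖} := by
    ext z
    rw [Set.mem_ofPred_eq, Set.mem_ofPred_eq, norm_average_sub F m hn, ← hscale, one_div,
      ← div_eq_inv_mul, lt_div_iff₀ hn0, mul_comm]
  rw [hset, ENNReal.ofReal_min, le_min_iff]
  constructor
  · have h := bernstein_measure_pi_norm_sum hFc (by positivity) hLc h0c hσ hWc n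
      (t := 2 * t) (by positivity)
    refine le_trans (measure_mono fun z hz => ?_) h
    rw [Set.mem_ofPred_eq] at hz ⊢
    refine lt_of_le_of_lt ?_ hz
    gcongr
  · have h := chebyshev_measure_pi_norm_sum hFc (.of_bound hFc.aestronglyMeasurable _ hLc) h0c
      hσ hWc n (a := a * t) (by positivity)
    refine le_trans (measure_mono fun z hz => ?_) h
    rw [Set.mem_ofPred_eq] at hz ⊢
    refine lt_of_le_of_lt ?_ hz
    gcongr
    linarith

end Concentration

section DeviationProbability

theorem exp_le_sq_of_mem_Icc {t : ℝ} (ht : t ∈ Set.Icc (Real.log 2) (Real.log 2 + 1)) :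
    41 / 100 * Real.exp t ≤ 2 * t ^ 2 := by
  obtain ⟨u, rfl⟩ : ∃ u, t = Real.log 2 + u := ⟨t - Real.log 2, by ring⟩
  have hu0 : 0 ≤ u := by linarith [ht.1]
  have hu1 : u ≤ 1 := by linarith [ht.2]
  have hexp : Real.exp u ≤ 1 + u + u ^ 2 := by
    linarith [(le_abs_self _).trans (Real.abs_exp_sub_one_sub_id_le (x := u) (by
      rwa [abs_of_nonneg hu0]))]
  have hsq : (0.693 + u) ^ 2 ≤ (Real.log 2 + u) ^ 2 := by
    gcongr
    linarith [Real.log_two_gt_d9]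
  rw [Real.exp_add, Real.exp_log two_pos]
  nlinarith

/- The tail bounds with `a = 2` and `a = 5 / 2` add up to `δ` only because the Chebyshev bound
takes over for small `t = log (2 / δ)`, where the Bernstein bound is useless. -/
theorem min_add_min_le {δ : ℝ} (hδ0 : 0 < δ) (hδ1 : δ < 1) :
    min (2 * Real.exp (1 - 2 * Real.log (2 / δ))) (1 / (2 * Real.log (2 / δ)) ^ 2) +
      min (2 * Real.exp (1 - 2 * Real.log (2 / δ))) (1 / (5 / 2 * Real.log (2 / δ)) ^ 2) ≤ δ := by
  have hδ : δ = 2 * Real.exp (-Real.log (2 / δ)) := by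
    rw [Real.exp_neg, Real.exp_log (by positivity)]
    field_simp
  have ht : Real.log 2 ≤ Real.log (2 / δ) :=
    Real.log_le_log two_pos (by rw [le_div_iff₀ hδ0]; linarith)
  set t := Real.log (2 / δ)
  have ht0 : 0 < t := (Real.log_pos one_lt_two).trans_le ht
  rw [hδ]
  rcases le_total t (Real.log 2 + 1) with h | h
  · refine (add_le_add (min_le_right _ _) (min_le_right _ _)).trans ?_
    calc 1 / (2 * t) ^ 2 + 1 / (5 / 2 * t) ^ 2 = 41 / 100 / t ^ 2 := by field_simp; norm_num
      _ ≤ 2 / Real.exp t := by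
        rw [div_le_div_iff₀ (by positivity) (Real.exp_pos t)]
        exact exp_le_sq_of_mem_Icc ⟨ht, h⟩
      _ = 2 * Real.exp (-t) := by rw [Real.exp_neg, div_eq_mul_inv]
  · refine (add_le_add (min_le_left _ _) (min_le_left _ _)).trans ?_
    have hexp : 2 * Real.exp (1 - 2 * t) ≤ Real.exp (-t) := by
      nth_rewrite 1 [← Real.exp_log two_pos]
      rw [← Real.exp_add]
      exact Real.exp_le_exp.2 (by linarith)
    linarith

end DeviationProbability

/-! ### Covariance operators -/

theorem isCompactOperator_rankOne {V W : Type*} [NormedAddCommGroup V] [InnerProductSpace ℝ V]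
    [NormedAddCommGroup W] [InnerProductSpace ℝ W] (u : W) (v : V) :
    IsCompactOperator (rankOne ℝ u v : V →L[ℝ] W) := by
  rw [rankOne_def']
  exact (isCompactOperator_of_locallyCompactSpace_rng
    (ContinuousLinearMap.toSpanSingleton ℝ u)).comp_clm _

section FeatureMap

variable {X H : Type*} [NormedAddCommGroup H] [InnerProductSpace ℝ H] [CompleteSpace H]
  [RKHS ℝ H X ℝ]

theorem norm_featureMap_le {κ : ℝ} (hκ : 0 ≤ κ) {x : X} (hk : scalarKernel H x x ≤ κ ^ 2) :
    ‖featureMap H x‖ ≤ κ := by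
  rw [← sq_le_sq₀ (norm_nonneg _) hκ, ← real_inner_self_eq_norm_sq, inner_featureMap,
    featureMap_apply]
  exact hk

variable [MeasurableSpace X]

theorem measurable_rkhs (hk_meas : ∀ t : X, Measurable fun x => scalarKernel H x t) (f : H) :
    Measurable fun x => f x := by
  have hf : f ∈ closure (Submodule.span ℝ {RKHS.kerFun H x v | (x : X) (v : ℝ)} : Set H) := by
    rw [← Submodule.topologicalClosure_coe, RKHS.kerFun_dense]
    trivial
  obtain ⟨u, hu, hlim⟩ := mem_closure_iff_seq_limit.1 hf
  refine measurable_of_tendsto_metrizable (f := fun n x => u n x) (fun n => ?_)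
    (tendsto_pi_nhds.2 fun x => ((RKHS.continuous_eval x).tendsto f).comp hlim)
  refine Submodule.span_induction (p := fun g _ => Measurable fun x => g x) ?_ ?_ ?_ ?_ (hu n)
  · rintro _ ⟨t, v, rfl⟩
    have h : ∀ x, RKHS.kerFun H t v x = v * scalarKernel H x t := fun x => by
      rw [RKHS.kerFun_apply, scalarKernel, ← smul_eq_mul, ← map_smul, smul_eq_mul, mul_one]
    simp only [h]
    exact (hk_meas t).const_mul v
  · simp only [RKHS.coe_zero]
    exact measurable_const
  · intro g h _ _ hg hh
    simp only [RKHS.coe_add]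
    exact hg.add hh
  · intro c g _ hg
    simp only [RKHS.coe_smul]
    exact hg.const_smul c

variable [TopologicalSpace.SeparableSpace H]

theorem stronglyMeasurable_featureMap (hk_meas : ∀ t : X, Measurable fun x => scalarKernel H x t) :
    StronglyMeasurable (featureMap H : X → H) := by
  have := countable_of_hilbertBasis (someBasis H)
  refine stronglyMeasurable_of_tendsto (f := fun (s : Finset (basisIndex H)) x =>
    ∑ i ∈ s, (someBasis H).repr (featureMap H x) i • someBasis H i) Filter.atTop (fun s => ?_)
    (tendsto_pi_nhds.2 fun x => (someBasis H).hasSum_repr (featureMap H x))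
  refine Finset.stronglyMeasurable_fun_sum _ fun i _ => ?_
  simp only [HilbertBasis.repr_apply_apply, real_inner_comm (featureMap H _), inner_featureMap]
  exact (measurable_rkhs hk_meas _).stronglyMeasurable.smul_const _

theorem memLp_featureMap (qX : Measure X) [IsFiniteMeasure qX] {κ : ℝ} (hκ : 0 ≤ κ)
    (hk_meas : ∀ t : X, Measurable fun x => scalarKernel H x t)
    (hk : ∀ x : X, scalarKernel H x x ≤ κ ^ 2) (p : ℝ≥0∞) :
    MemLp (featureMap H : X → H) p qX :=
  .of_bound (stronglyMeasurable_featureMap hk_meas).aestronglyMeasurable κ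
    (.of_forall fun x => norm_featureMap_le hκ (hk x))

end FeatureMap

section CovOp

variable {X H Y : Type*} [MeasurableSpace X] [NormedAddCommGroup H] [InnerProductSpace ℝ H]
  [CompleteSpace H] [RKHS ℝ H X ℝ] [NormedAddCommGroup Y] [InnerProductSpace ℝ Y] [CompleteSpace Y]
  {qX : Measure X} (hφ : MemLp (featureMap H : X → H) 2 qX)

include hφ

theorem integrable_rankOne_featureMap :
    Integrable (fun x => rankOne ℝ (featureMap H x) (featureMap H x)) qX := by
  have hc : Continuous fun v : H => (rankOne ℝ v v : H →L[ℝ] H) :=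
    (rankOne ℝ (E := H) (F := H)).continuous.clm_apply continuous_id
  refine ((memLp_two_iff_integrable_sq_norm hφ.1).1 hφ).mono (hc.comp_aestronglyMeasurable hφ.1)
    (.of_forall fun x => ?_)
  rw [norm_rankOne, norm_pow, norm_norm, sq]

theorem covOp_apply (h : H) :
    covOp H qX h = ∫ x, ⟪featureMap H x, h⟫_ℝ • featureMap H x ∂qX := by
  rw [covOp, ContinuousLinearMap.integral_apply (integrable_rankOne_featureMap hφ)]
  simp only [rankOne_apply]

theorem integrable_inner_smul_featureMap (h : H) :
    Integrable (fun x => ⟪featureMap H x, h⟫_ℝ • featureMap H x) qX := by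
  simpa only [rankOne_apply] using
    (integrable_rankOne_featureMap hφ).apply_continuousLinearMap h

theorem inner_covOp (u v : H) :
    ⟪u, covOp H qX v⟫_ℝ = ∫ x, ⟪featureMap H x, u⟫_ℝ * ⟪featureMap H x, v⟫_ℝ ∂qX := by
  rw [covOp_apply hφ, ← integral_inner (integrable_inner_smul_featureMap hφ v)]
  simp only [real_inner_smul_right, real_inner_comm u, mul_comm]

theorem isPositive_covOp : (covOp H qX).IsPositive := by
  refine (ContinuousLinearMap.isPositive_iff _).2 ⟨fun u v => ?_, fun u => ?_⟩
  · change ⟪covOp H qX u, v⟫_ℝ = ⟪u, covOp H qX v⟫_ℝ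
    rw [real_inner_comm, inner_covOp hφ, inner_covOp hφ]
    simp only [mul_comm]
  · rw [real_inner_comm, inner_covOp hφ]
    exact integral_nonneg fun x => mul_self_nonneg _

theorem isCompactOperator_covOp [IsProbabilityMeasure qX] : IsCompactOperator (covOp H qX) :=
  have hconv : Convex ℝ (compactOperator (RingHom.id ℝ) H H : Set (H →L[ℝ] H)) :=
    (compactOperator (RingHom.id ℝ) H H).convex
  hconv.integral_mem isClosed_setOfPred_isCompactOperator
    (.of_forall fun _ => isCompactOperator_rankOne _ _) (integrable_rankOne_featureMap hφ)

omit hφ in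
theorem norm_covOp_le [IsProbabilityMeasure qX] {κ : ℝ} (hκ : ∀ x, ‖(featureMap H x : H)‖ ≤ κ) :
    ‖covOp H qX‖ ≤ κ ^ 2 := by
  have h := norm_integral_le_of_norm_le_const (μ := qX) (C := κ ^ 2)
    (f := fun x => rankOne ℝ (featureMap H x : H) (featureMap H x)) (.of_forall fun x => by
      rw [norm_rankOne, ← sq]
      exact pow_le_pow_left₀ (norm_nonneg _) (hκ x) 2)
  rwa [probReal_univ, mul_one] at h

theorem lintegral_inner_featureMap_sq (u : H) :
    ∫⁻ x, ‖⟪featureMap H x, u⟫_ℝ‖ₑ ^ 2 ∂qX = ENNReal.ofReal ⟪u, covOp H qX u⟫_ℝ := by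
  have hint : Integrable (fun x => ⟪featureMap H x, u⟫_ℝ * ⟪featureMap H x, u⟫_ℝ) qX := by
    simpa only [real_inner_smul_left] using
      (integrable_inner_smul_featureMap hφ u).inner_const (𝕜 := ℝ) u
  rw [inner_covOp hφ,
    ofReal_integral_eq_lintegral_ofReal hint (.of_forall fun x => mul_self_nonneg _)]
  refine lintegral_congr fun x => ?_
  rw [← sq, ← sq_abs, ENNReal.ofReal_pow (abs_nonneg _), ← Real.norm_eq_abs, ofReal_norm]

theorem lintegral_enorm_apply_featureMap_sq [TopologicalSpace.SeparableSpace Y] {R : H →L[ℝ] H}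
    (hR : IsSelfAdjoint R) (hRR : R * R = covOp H qX) (A : H →L[ℝ] Y) :
    ∫⁻ x, ‖A (featureMap H x)‖ₑ ^ 2 ∂qX = hsNormSq (A ∘L R) := by
  have := countable_of_hilbertBasis (someBasis Y)
  rw [hsNormSq, tsum_enorm_sq_eq_adjoint _ (someBasis Y)]
  simp only [← tsum_enorm_inner_sq (someBasis Y) (A _), ← ContinuousLinearMap.adjoint_inner_right]
  rw [lintegral_tsum fun j => (hφ.1.inner_const.enorm).pow_const 2]
  refine tsum_congr fun j => ?_
  rw [lintegral_inner_featureMap_sq hφ, ContinuousLinearMap.adjoint_comp, hR.adjoint_eq, ← hRR,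
    mul_apply_eq_comp, ← hR.isSymmetric.apply_clm, real_inner_self_eq_norm_sq,
    ENNReal.ofReal_pow (norm_nonneg _), ofReal_norm]
  rfl

theorem eLpNorm_apply_featureMap [TopologicalSpace.SeparableSpace Y] {R : H →L[ℝ] H}
    (hR : IsSelfAdjoint R) (hRR : R * R = covOp H qX) (A : H →L[ℝ] Y) :
    eLpNorm (fun x => A (featureMap H x)) 2 qX = hsENorm (A ∘L R) := by
  rw [eLpNorm_eq_lintegral_rpow_enorm_toReal two_ne_zero ENNReal.ofNat_ne_top, hsENorm,
    ← lintegral_enorm_apply_featureMap_sq hφ hR hRR]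
  simp only [ENNReal.toReal_ofNat, ENNReal.rpow_two]

end CovOp

section EffectiveDimension

variable {ι X H : Type*} [NormedAddCommGroup H] [InnerProductSpace ℝ H]
  {e : HilbertBasis ι ℝ H} {a r s : ι → ℝ} {A R S : H →L[ℝ] H} {lam : ℝ}

theorem IsDiag.inverse_add_smul_id (hA : IsDiag e a A) (hS : IsDiag e s S)
    (hs : ∀ i, (a i + lam) * (s i * s i) = 1) :
    Ring.inverse (A + lam • ContinuousLinearMap.id ℝ H) = S * S := by
  have hU : IsDiag e (fun i => a i + lam) (A + lam • ContinuousLinearMap.id ℝ H) :=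
    (hA.add (IsDiag.one.smul lam)).congr fun i => by rw [mul_one]
  exact Ring.inverse_unit
    ⟨_, S * S, (hU.mul (hS.mul hS)).unique (IsDiag.one.congr fun i => (hs i).symm),
      ((hS.mul hS).mul hU).unique (IsDiag.one.congr fun i => by rw [mul_comm, hs i])⟩

variable [CompleteSpace H]

theorem IsDiag.effDim_eq_toReal_hsNormSq (hA : IsDiag e a A) (hR : IsDiag e r R) (hRR : R * R = A)
    (hS : IsDiag e s S) (hs : ∀ i, (a i + lam) * (s i * s i) = 1) :
    effDim A lam = (hsNormSq (S * R)).toReal := by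
  have hSR := hS.mul hR
  have hop : A ∘L (S * S) = (S * R) * (S * R) := by
    rw [← hRR]
    exact ((hR.mul hR).mul (hS.mul hS)).unique ((hSR.mul hSR).congr fun i => by ring)
  have hnn : ∀ i, ⟪((S * R) * (S * R)) (someBasis H i), someBasis H i⟫_ℝ =
      (‖(S * R) (someBasis H i)‖ₑ ^ 2).toReal := fun i => by
    rw [mul_apply_eq_comp, hSR.isSymmetric.apply_clm, real_inner_self_eq_norm_sq,
      ENNReal.toReal_pow, toReal_enorm]
  rw [effDim, hA.inverse_add_smul_id hS hs, hop, opTrace, hsNormSq,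
    ENNReal.tsum_toReal_eq fun i => by finiteness]
  simp only [hnn]

variable [MeasurableSpace X] [TopologicalSpace.SeparableSpace H] [RKHS ℝ H X ℝ] {qX : Measure X}

theorem IsDiag.integral_norm_apply_featureMap_sq (hφ : MemLp (featureMap H : X → H) 2 qX)
    (hA : IsDiag e a (covOp H qX)) (hR : IsDiag e r R) (hRR : R * R = covOp H qX)
    (hS : IsDiag e s S) (hs : ∀ i, (a i + lam) * (s i * s i) = 1) :
    ∫ x, ‖S (featureMap H x)‖ ^ 2 ∂qX = effDim (covOp H qX) lam := by
  rw [hA.effDim_eq_toReal_hsNormSq hR hRR hS hs, ContinuousLinearMap.mul_def,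
    ← lintegral_enorm_apply_featureMap_sq hφ hR.isSymmetric.isSelfAdjoint hRR,
    integral_eq_lintegral_of_nonneg_ae (.of_forall fun x => sq_nonneg _)
      ((S.continuous.comp_aestronglyMeasurable hφ.1).norm.pow 2)]
  simp only [ENNReal.ofReal_pow (norm_nonneg _), ofReal_norm]

end EffectiveDimension

section Empirical

variable {X H Y : Type*} [NormedAddCommGroup H] [InnerProductSpace ℝ H] [CompleteSpace H]
  [RKHS ℝ H X ℝ] {n : ℕ} {β : X → ℝ}

theorem norm_average_le {E : Type*} [NormedAddCommGroup E] [NormedSpace ℝ E] {v : Fin n → E}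
    {C : ℝ} (hC : 0 ≤ C) (hv : ∀ i, ‖v i‖ ≤ C) : ‖(1 / n : ℝ) • ∑ i, v i‖ ≤ C := by
  have h := norm_sum_le_of_le Finset.univ fun i _ => hv i
  rw [Finset.sum_const, Finset.card_univ, Fintype.card_fin, nsmul_eq_mul] at h
  rw [norm_smul, Real.norm_of_nonneg (by positivity), one_div]
  exact inv_mul_le_of_le_mul₀ (by positivity) hC h

theorem isPositive_empCovOp (hβ : ∀ x, 0 ≤ β x) (z : Fin n → X × Y) :
    (empCovOp H β z).IsPositive :=
  (ContinuousLinearMap.isPositive_sum _ fun i _ =>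
    (isPositive_rankOne_self _).smul_of_nonneg (hβ (z i).1)).smul_of_nonneg (by positivity)

theorem isCompactOperator_empCovOp (z : Fin n → X × Y) : IsCompactOperator (empCovOp H β z) :=
  show empCovOp H β z ∈ compactOperator (RingHom.id ℝ) H H from
    Submodule.smul_mem _ _ (Submodule.sum_mem _ fun _ _ =>
      Submodule.smul_mem _ _ (isCompactOperator_rankOne _ _))

theorem norm_empCovOp_le {κ b : ℝ} (hκ : 0 ≤ κ) (hk : ∀ x : X, scalarKernel H x x ≤ κ ^ 2)
    (hb : 0 ≤ b) (hβ : ∀ x, 0 ≤ β x) (hβ_le : ∀ x, β x ≤ b) (z : Fin n → X × Y) :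
    ‖empCovOp H β z‖ ≤ b * κ ^ 2 := by
  refine norm_average_le (by positivity) fun i => ?_
  have hφ := norm_featureMap_le hκ (hk (z i).1)
  rw [norm_smul, norm_rankOne, Real.norm_of_nonneg (hβ _), sq]
  gcongr
  exact hβ_le _

variable [NormedAddCommGroup Y] [InnerProductSpace ℝ Y]

theorem empCrossCovOp_apply_eq_zero (hβ : ∀ x, 0 ≤ β x) (z : Fin n → X × Y) {u : H}
    (hu : empCovOp H β z u = 0) : empCrossCovOp H β z u = 0 := by
  rcases n.eq_zero_or_pos with rfl | hn
  · simp [empCrossCovOp]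
  have h : ∑ i, β (z i).1 * ⟪featureMap H (z i).1, u⟫_ℝ ^ 2 = 0 := by
    have h0 : ⟪u, empCovOp H β z u⟫_ℝ = 0 := by rw [hu, inner_zero_right]
    simpa [empCovOp, inner_sum, real_inner_smul_right, real_inner_comm u, ← sq, hn.ne'] using h0
  rw [Finset.sum_eq_zero_iff_of_nonneg fun i _ => mul_nonneg (hβ _) (sq_nonneg _)] at h
  have hi : ∀ i, β (z i).1 = 0 ∨ ⟪featureMap H (z i).1, u⟫_ℝ = 0 := by
    simpa using h
  simp only [empCrossCovOp, smul_apply, sum_apply, rankOne_apply]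
  rw [Finset.sum_eq_zero fun i _ => ?_, smul_zero]
  rcases hi i with h0 | h0 <;> rw [h0] <;> simp only [zero_smul, smul_zero]

end Empirical

/-! ### Index functions and regularization families -/

section Scalar

variable {g : ℝ → ℝ → ℝ} {φ : ℝ → ℝ} {s D B γ ν γν c lam σ : ℝ}

theorem IsIndexFunction.pos (hφ : IsIndexFunction φ) {t : ℝ} (ht : 0 < t) : 0 < φ t := by
  rw [← hφ.map_zero]
  exact hφ.strictMonoOn Set.self_mem_Ici ht.le ht

theorem IsIndexFunction.nonneg (hφ : IsIndexFunction φ) {t : ℝ} (ht : 0 ≤ t) : 0 ≤ φ t := by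
  rw [← hφ.map_zero]
  exact hφ.strictMonoOn.monotoneOn Set.self_mem_Ici ht ht

open Filter Topology in
theorem IsIndexFunction.tendsto_zero (hφ : IsIndexFunction φ) : Tendsto φ (𝓝[>] 0) (𝓝 0) := by
  have h := hφ.continuousOn 0 Set.self_mem_Ici
  rw [ContinuousWithinAt, hφ.map_zero] at h
  exact h.mono_left (nhdsWithin_mono _ Set.Ioi_subset_Ici_self)

-- Otherwise `t ^ ν / (φ t * √t) ≥ 1 / φ t` would be unbounded as `t → 0`.
theorem Covers.half_lt (hcov : Covers ν s (fun t => φ t * √t) c) (hφ : IsIndexFunction φ)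
    (hs : 0 < s) : 1 / 2 < ν := by
  by_contra! hν
  obtain ⟨hc, hcov⟩ := hcov
  have hQ : 0 < s ^ ν / (φ s * √s) := by
    have := hφ.pos hs
    positivity
  obtain ⟨t, ht, ht0, ht1⟩ := ((hφ.tendsto_zero.eventually_lt_const (div_pos hc hQ)).and
    (Ioc_mem_nhdsGT (lt_min hs one_pos))).exists
  have hts := ht1.trans (min_le_left _ _)
  have hφt := hφ.pos ht0
  have hpow : √t ≤ t ^ ν := by
    rw [Real.sqrt_eq_rpow]
    exact Real.rpow_le_rpow_of_exponent_ge ht0 (ht1.trans (min_le_right _ _)) hν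
  have hle : 1 / φ t ≤ t ^ ν / (φ t * √t) := by
    rw [div_le_div_iff₀ hφt (by positivity), one_mul, mul_comm]
    gcongr
  have h := (mul_le_mul_of_nonneg_left hle hc.le).trans (hcov t ⟨ht0, hts⟩ s ⟨hts, le_rfl⟩)
  rw [mul_one_div, div_le_iff₀ hφt] at h
  rw [lt_div_iff₀ hQ] at ht
  linarith

theorem Covers.le_mul_rpow (hcov : Covers ν s (fun t => φ t * √t) c) (hφ : IsIndexFunction φ)
    (hlam : lam ∈ Set.Ioc 0 s) (hσ : σ ∈ Set.Icc lam s) :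
    φ σ ≤ 1 / c * φ lam * lam ^ (-(ν - 1 / 2)) * σ ^ (ν - 1 / 2) := by
  obtain ⟨hc, hcov⟩ := hcov
  have hl := hlam.1
  have hσ0 := hl.trans_le hσ.1
  have hφl := hφ.pos hl
  have hφσ := hφ.pos hσ0
  have hsplit : ∀ x : ℝ, 0 < x → x ^ ν = x ^ (ν - 1 / 2) * √x := fun x hx => by
    rw [Real.sqrt_eq_rpow, ← Real.rpow_add hx, sub_add_cancel]
  have hq := hcov lam hlam σ hσ
  simp only [hsplit lam hl, hsplit σ hσ0] at hq
  rw [mul_div_mul_right _ _ (by positivity), mul_div_mul_right _ _ (by positivity),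
    ← mul_div_assoc, div_le_div_iff₀ hφl hφσ] at hq
  calc φ σ = 1 / c * lam ^ (-(ν - 1 / 2)) * (c * lam ^ (ν - 1 / 2) * φ σ) := by
        rw [Real.rpow_neg hl.le]
        field_simp
    _ ≤ 1 / c * lam ^ (-(ν - 1 / 2)) * (σ ^ (ν - 1 / 2) * φ lam) := by gcongr
    _ = 1 / c * φ lam * lam ^ (-(ν - 1 / 2)) * σ ^ (ν - 1 / 2) := by ring

theorem Covers.le_max_mul_rpow_add (hcov : Covers ν s (fun t => φ t * √t) c)
    (hφ : IsIndexFunction φ) (hlam : lam ∈ Set.Ioc 0 s) (hσ : σ ∈ Set.Icc 0 s) :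
    φ σ ≤ max 1 (1 / c) * φ lam * lam ^ (-(ν - 1 / 2)) * (σ + lam) ^ (ν - 1 / 2) := by
  have hl := hlam.1
  have hσ0 := hσ.1
  have hφl := hφ.pos hl
  have hexp : 0 ≤ ν - 1 / 2 := by linarith [hcov.half_lt hφ (hl.trans_le hlam.2)]
  rcases le_total σ lam with h | h
  · calc φ σ ≤ φ lam := hφ.strictMonoOn.monotoneOn hσ0 hl.le h
      _ = 1 * φ lam * lam ^ (-(ν - 1 / 2)) * lam ^ (ν - 1 / 2) := by
        rw [mul_assoc, ← Real.rpow_add hl, neg_add_cancel, Real.rpow_zero, one_mul, mul_one]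
      _ ≤ _ := by
        gcongr
        · exact le_max_left _ _
        · linarith
  · refine (hcov.le_mul_rpow hφ hlam ⟨h, hσ.2⟩).trans ?_
    gcongr
    · exact le_max_right _ _
    · linarith

theorem HasQualification.const_nonneg (hν : HasQualification g s ν γν) (hs : 0 < s) : 0 ≤ γν :=
  nonneg_of_mul_nonneg_left
    ((by positivity : (0 : ℝ) ≤ _).trans (hν.residual_le s ⟨hs, le_rfl⟩ s ⟨hs, le_rfl⟩))
    (by positivity)

-- The residual tends to `1` as `σ → 0`, because `g lam` is bounded.
theorem IsRegularizationFamily.one_le (hg : IsRegularizationFamily g s D B γ) (hs : 0 < s) :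
    1 ≤ γ := by
  by_contra! hγ
  have hB := hg.B_pos
  have := sub_pos.2 hγ
  set σ := min s ((1 - γ) * s / (2 * B))
  have hσ : σ ∈ Set.Ioc 0 s := ⟨lt_min hs (by positivity), min_le_left _ _⟩
  have hsmall : σ * g s σ ≤ (1 - γ) / 2 := by
    calc σ * g s σ ≤ σ * (B / s) := mul_le_mul_of_nonneg_left
          ((le_abs_self _).trans (hg.abs_le s ⟨hs, le_rfl⟩ σ hσ)) hσ.1.le
      _ ≤ (1 - γ) * s / (2 * B) * (B / s) := by
          gcongr
          exact min_le_right _ _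
      _ = (1 - γ) / 2 := by field_simp
  linarith [(le_abs_self _).trans (hg.abs_residual_le s ⟨hs, le_rfl⟩ σ hσ)]

theorem IsRegularizationFamily.abs_residual_le_of_mem_Icc
    (hg : IsRegularizationFamily g s D B γ) (hlam : lam ∈ Set.Ioc 0 s) (hσ : σ ∈ Set.Icc 0 s) :
    |1 - σ * g lam σ| ≤ γ := by
  rcases hσ.1.eq_or_lt with rfl | h
  · simpa using hg.one_le (hlam.1.trans_le hlam.2)
  · exact hg.abs_residual_le lam hlam σ ⟨h, hσ.2⟩

theorem IsRegularizationFamily.abs_add_mul_le (hg : IsRegularizationFamily g s D B γ)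
    (hlam : lam ∈ Set.Ioc 0 s) (hσ : σ ∈ Set.Ioc 0 s) : |(σ + lam) * g lam σ| ≤ B + D := by
  have hB : |lam * g lam σ| ≤ B := by
    rw [abs_mul, abs_of_pos hlam.1, mul_comm]
    exact (le_div_iff₀ hlam.1).1 (hg.abs_le lam hlam σ hσ)
  rw [add_mul]
  linarith [abs_add_le (σ * g lam σ) (lam * g lam σ), hg.abs_mul_le lam hlam σ hσ]

theorem HasQualification.abs_residual_mul_add_rpow_le (hν : HasQualification g s ν γν)
    (hg : IsRegularizationFamily g s D B γ) (hlam : lam ∈ Set.Ioc 0 s) (hσ : σ ∈ Set.Icc 0 s) :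
    |1 - σ * g lam σ| * (σ + lam) ^ ν ≤ 2 ^ ν * (γν + γ) * lam ^ ν := by
  have hl := hlam.1
  have hσ0 := hσ.1
  have hγ := hg.γ_pos
  have hγν := hν.const_nonneg (hl.trans_le hlam.2)
  have hν0 := hν.pos
  rcases le_total σ lam with h | h
  · calc |1 - σ * g lam σ| * (σ + lam) ^ ν ≤ γ * (2 * lam) ^ ν := by
          gcongr
          · exact hg.abs_residual_le_of_mem_Icc hlam hσ
          · linarith
      _ = 2 ^ ν * γ * lam ^ ν := by rw [Real.mul_rpow two_pos.le hl.le]; ring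
      _ ≤ _ := by gcongr; linarith
  · calc |1 - σ * g lam σ| * (σ + lam) ^ ν ≤ |1 - σ * g lam σ| * (2 * σ) ^ ν := by
          gcongr
          linarith
      _ = 2 ^ ν * (|1 - σ * g lam σ| * σ ^ ν) := by
          rw [Real.mul_rpow two_pos.le hσ0]; ring
      _ ≤ 2 ^ ν * (γν * lam ^ ν) := mul_le_mul_of_nonneg_left
          (hν.residual_le lam hlam σ ⟨hl.trans_le h, hσ.2⟩) (by positivity)
      _ ≤ _ := by rw [← mul_assoc]; gcongr; linarith

theorem HasQualification.abs_residual_mul_add_rpow_le_of_le (hν : HasQualification g s ν γν)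
    (hg : IsRegularizationFamily g s D B γ) (hlam : lam ∈ Set.Ioc 0 s) (hσ : σ ∈ Set.Icc 0 s)
    {p : ℝ} (hp : p ≤ ν) :
    |1 - σ * g lam σ| * (σ + lam) ^ p ≤ 2 ^ ν * (γν + γ) * lam ^ p := by
  have hl := hlam.1
  have hle : lam ≤ σ + lam := le_add_of_nonneg_left hσ.1
  have hsum : 0 < σ + lam := hl.trans_le hle
  have hγ := hg.γ_pos
  have hγν := hν.const_nonneg (hl.trans_le hlam.2)
  calc |1 - σ * g lam σ| * (σ + lam) ^ p
      = |1 - σ * g lam σ| * (σ + lam) ^ ν * (σ + lam) ^ (p - ν) := by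
        rw [mul_assoc, ← Real.rpow_add hsum, add_sub_cancel]
    _ ≤ 2 ^ ν * (γν + γ) * lam ^ ν * lam ^ (p - ν) := by
        gcongr ?_ * ?_
        · exact hν.abs_residual_mul_add_rpow_le hg hlam hσ
        · exact Real.rpow_le_rpow_of_nonpos hl hle (by linarith)
    _ = _ := by rw [mul_assoc, ← Real.rpow_add hl, add_sub_cancel]

end Scalar

/-! ### Comparison of perturbed operators -/

section DiagPow

variable {ι H : Type*} [NormedAddCommGroup H] [InnerProductSpace ℝ H]
  {e : HilbertBasis ι ℝ H} {u : ι → ℝ} {U : H →L[ℝ] H} {l C : ℝ}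

/-- The power `U ^ p` of the operator `U` that is diagonal in the basis `e` with eigenvalues `u`.
It is meaningful, for every real `p`, when `u` takes its values in a compact subset of `(0, ∞)`. -/
def diagPow (e : HilbertBasis ι ℝ H) (u : ι → ℝ) (p : ℝ) : H →L[ℝ] H :=
  diagOp e fun i => u i ^ p

theorem isDiag_diagPow (hl : 0 < l) (hu : ∀ i, u i ∈ Set.Icc l C) (p : ℝ) :
    IsDiag e (fun i => u i ^ p) (diagPow e u p) := by
  refine isDiag_diagOp e (C := l ^ p + C ^ p) fun i => ?_
  obtain ⟨hlu, huC⟩ := hu i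
  have hu0 := hl.trans_le hlu
  have hC0 := hu0.trans_le huC
  rw [abs_of_nonneg (by positivity)]
  rcases le_total 0 p with hp | hp
  · exact (Real.rpow_le_rpow hu0.le huC hp).trans (le_add_of_nonneg_left (by positivity))
  · exact (Real.rpow_le_rpow_of_nonpos hl hlu hp).trans (le_add_of_nonneg_right (by positivity))

theorem diagPow_mul (hl : 0 < l) (hu : ∀ i, u i ∈ Set.Icc l C) (p q : ℝ) :
    diagPow e u p * diagPow e u q = diagPow e u (p + q) :=
  ((isDiag_diagPow hl hu p).mul (isDiag_diagPow hl hu q)).unique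
    ((isDiag_diagPow hl hu (p + q)).congr fun i => Real.rpow_add (hl.trans_le (hu i).1) p q)

theorem diagPow_zero (hl : 0 < l) (hu : ∀ i, u i ∈ Set.Icc l C) : diagPow e u 0 = 1 :=
  (isDiag_diagPow hl hu 0).unique (IsDiag.one.congr fun _ => (Real.rpow_zero _).symm)

theorem diagPow_neg_mul_self (hl : 0 < l) (hu : ∀ i, u i ∈ Set.Icc l C) (p : ℝ) :
    diagPow e u (-p) * diagPow e u p = 1 := by
  rw [diagPow_mul hl hu, neg_add_cancel, diagPow_zero hl hu]

theorem IsDiag.pow_eq_diagPow (hU : IsDiag e u U) (hl : 0 < l) (hu : ∀ i, u i ∈ Set.Icc l C)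
    (m : ℕ) : U ^ m = diagPow e u m := by
  induction m with
  | zero => rw [pow_zero, Nat.cast_zero, diagPow_zero hl hu]
  | succ m ih =>
    have h1 : U = diagPow e u 1 :=
      hU.unique ((isDiag_diagPow hl hu 1).congr fun _ => Real.rpow_one _)
    rw [pow_succ, ih, Nat.cast_succ, ← diagPow_mul hl hu, ← h1]

theorem norm_diagPow_le (hl : 0 < l) (hu : ∀ i, u i ∈ Set.Icc l C) {p : ℝ} (hp : p ≤ 0) :
    ‖diagPow e u p‖ ≤ l ^ p := by
  refine (isDiag_diagPow hl hu p).norm_le (by positivity) fun i => ?_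
  have hu0 := hl.trans_le (hu i).1
  rw [abs_of_nonneg (by positivity)]
  exact Real.rpow_le_rpow_of_nonpos hl (hu i).1 hp

end DiagPow

theorem pow_sub_pow_eq_sum {A : Type*} [Ring A] (x y : A) (m : ℕ) :
    x ^ m - y ^ m = ∑ j ∈ Finset.range m, x ^ (m - 1 - j) * (x - y) * y ^ j := by
  induction m with
  | zero => simp
  | succ m ih =>
    have h : ∀ j ∈ Finset.range m, x ^ (m + 1 - 1 - j) * (x - y) * y ^ j =
        x * (x ^ (m - 1 - j) * (x - y) * y ^ j) := fun j hj => by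
      rw [show m + 1 - 1 - j = (m - 1 - j) + 1 by have := Finset.mem_range.1 hj; omega, pow_succ']
      simp only [mul_assoc]
    rw [Finset.sum_range_succ, Finset.sum_congr rfl h, ← Finset.mul_sum, ← ih]
    simp only [Nat.add_sub_cancel, Nat.sub_self, pow_zero, one_mul, pow_succ']
    noncomm_ring

section Comparison

variable {ι κ H : Type*} [NormedAddCommGroup H] [InnerProductSpace ℝ H]
  {e : HilbertBasis ι ℝ H} {e' : HilbertBasis κ ℝ H} {u : ι → ℝ} {v : κ → ℝ}
  {U Uh : H →L[ℝ] H} {l C C' η : ℝ}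

-- `(U - Uh) x` is at most half of `U x`, since `U - Uh = ((U - Uh) U ^ (-1/2)) U ^ (-1/2) U`.
theorem norm_apply_le_two_mul_norm_apply (hl : 0 < l) (hU : IsDiag e u U)
    (hu : ∀ i, u i ∈ Set.Icc l C) (hη : ‖(U - Uh) * diagPow e u (-(1 / 2))‖ ≤ √l / 2) (x : H) :
    ‖U x‖ ≤ 2 * ‖Uh x‖ := by
  have hfactor : U - Uh = (U - Uh) * diagPow e u (-(1 / 2)) * diagPow e u (-(1 / 2)) * U := by
    have hU1 := hU.pow_eq_diagPow hl hu 1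
    rw [pow_one, Nat.cast_one] at hU1
    rw [mul_assoc, mul_assoc, hU1, diagPow_mul hl hu, diagPow_mul hl hu,
      show (-(1 / 2) + (-(1 / 2) + 1) : ℝ) = 0 by norm_num, diagPow_zero hl hu, mul_one]
  have hnorm : ‖(U - Uh) * diagPow e u (-(1 / 2)) * diagPow e u (-(1 / 2))‖ ≤ 1 / 2 := by
    calc _ ≤ √l / 2 * l ^ (-(1 / 2) : ℝ) := norm_mul_le_of_le hη
          (norm_diagPow_le hl hu (by norm_num))
      _ = 1 / 2 := by
          rw [Real.rpow_neg hl.le, ← Real.sqrt_eq_rpow]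
          field_simp
  have hsub : ‖(U - Uh) x‖ ≤ 1 / 2 * ‖U x‖ := by
    rw [hfactor]
    exact ContinuousLinearMap.le_of_opNorm_le _ hnorm (U x)
  rw [sub_apply] at hsub
  linarith [norm_le_norm_add_norm_sub' (U x) (Uh x)]

variable [Countable ι] [Countable κ]

theorem norm_diagPow_mul_diagPow_neg_le (hl : 0 < l) (hU : IsDiag e u U) (hUh : IsDiag e' v Uh)
    (hu : ∀ i, u i ∈ Set.Icc l C) (hv : ∀ j, v j ∈ Set.Icc l C')
    (hη : ‖(U - Uh) * diagPow e u (-(1 / 2))‖ ≤ √l / 2) {θ : ℝ} (h0 : 0 ≤ θ) (h1 : θ ≤ 1) :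
    ‖diagPow e u θ * diagPow e' v (-θ)‖ ≤ 2 ^ θ := by
  refine ContinuousLinearMap.opNorm_le_bound _ (by positivity) fun x => ?_
  have h := heinz hU hUh (fun i => hl.trans_le (hu i).1) (fun j => hl.trans_le (hv j).1) two_pos
    (norm_apply_le_two_mul_norm_apply hl hU hu hη) h0 h1 (isDiag_diagPow hl hu θ)
    (isDiag_diagPow hl hv θ) (diagPow e' v (-θ) x)
  have hx : diagPow e' v θ (diagPow e' v (-θ) x) = x := by
    have := DFunLike.congr_fun (diagPow_mul (e := e') hl hv θ (-θ)) x
    rwa [add_neg_cancel, diagPow_zero hl hv] at this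
  rwa [hx] at h

variable [CompleteSpace H] {R F : H →L[ℝ] H} {r : ι → ℝ} {f : κ → ℝ}

theorem norm_diagPow_neg_half_mul_le (hl : 0 < l) (hU : IsDiag e u U) (hUh : IsDiag e' v Uh)
    (hu : ∀ i, u i ∈ Set.Icc l C) (hv : ∀ j, v j ∈ Set.Icc l C')
    (hη : ‖(U - Uh) * diagPow e u (-(1 / 2))‖ ≤ √l / 2)
    (hR : IsDiag e r R) (hr : ∀ i, |r i| ≤ √(u i)) :
    ‖diagPow e' v (-(1 / 2)) * R‖ ≤ √2 := by
  have hadj : (R ∘L diagPow e' v (-(1 / 2))).adjoint = diagPow e' v (-(1 / 2)) ∘L R := by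
    rw [ContinuousLinearMap.adjoint_comp, (isDiag_diagPow hl hv _).adjoint_eq, hR.adjoint_eq]
  rw [ContinuousLinearMap.mul_def, ← hadj, LinearIsometryEquiv.norm_map]
  refine ContinuousLinearMap.opNorm_le_bound _ (by positivity) fun x => ?_
  have h := (diagPow e u (1 / 2) * diagPow e' v (-(1 / 2))).le_of_opNorm_le
    (norm_diagPow_mul_diagPow_neg_le hl hU hUh hu hv hη (by norm_num) (by norm_num)) x
  rw [← Real.sqrt_eq_rpow] at h
  refine (hR.norm_apply_le_of_le (isDiag_diagPow hl hu (1 / 2)) (fun i => ?_) _).trans h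
  rw [← Real.sqrt_eq_rpow, abs_of_nonneg (Real.sqrt_nonneg _)]
  exact hr i

theorem norm_diagPow_mul_mul_le (hl : 0 < l) (hU : IsDiag e u U) (hUh : IsDiag e' v Uh)
    (hu : ∀ i, u i ∈ Set.Icc l C) (hv : ∀ j, v j ∈ Set.Icc l C')
    (hη : ‖(U - Uh) * diagPow e u (-(1 / 2))‖ ≤ √l / 2)
    (hR : IsDiag e r R) (hr : ∀ i, |r i| ≤ √(u i)) (hF : IsDiag e' f F) {q c : ℝ} (hc : 0 ≤ c)
    (hf : ∀ j, |f j| * v j ^ (q + 1 / 2) ≤ c) :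
    ‖diagPow e' v q * F * R‖ ≤ c * √2 := by
  have hFq : IsDiag e' (fun j => v j ^ (q + 1 / 2) * f j) (diagPow e' v (q + 1 / 2) * F) :=
    (isDiag_diagPow hl hv _).mul hF
  have hfactor : diagPow e' v q * F =
      (diagPow e' v (q + 1 / 2) * F) * diagPow e' v (-(1 / 2)) := by
    refine ((isDiag_diagPow hl hv q).mul hF).unique
      ((hFq.mul (isDiag_diagPow hl hv _)).congr fun j => ?_)
    rw [mul_right_comm, ← Real.rpow_add (hl.trans_le (hv j).1), add_neg_cancel_right]
  rw [hfactor, mul_assoc]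
  refine norm_mul_le_of_le (hFq.norm_le hc fun j => ?_)
    (norm_diagPow_neg_half_mul_le hl hU hUh hu hv hη hR hr)
  rw [abs_mul, abs_of_nonneg (Real.rpow_nonneg (hl.le.trans (hv j).1) _), mul_comm]
  exact hf j

variable {Y : Type*} [NormedAddCommGroup Y] [InnerProductSpace ℝ Y] [CompleteSpace Y]

theorem hsENorm_comp_mul_le (hl : 0 < l) (hU : IsDiag e u U) (hUh : IsDiag e' v Uh)
    (hu : ∀ i, u i ∈ Set.Icc l C) (hv : ∀ j, v j ∈ Set.Icc l C')
    (hη : ‖(U - Uh) * diagPow e u (-(1 / 2))‖ ≤ √l / 2)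
    (hR : IsDiag e r R) (hr : ∀ i, |r i| ≤ √(u i)) (hF : IsDiag e' f F) {c d : ℝ} (hc : 0 ≤ c)
    (hf : ∀ j, |v j * f j| ≤ c) {ε : H →L[ℝ] Y} (hd : 0 ≤ d)
    (hε : hsENorm (ε ∘L diagPow e u (-(1 / 2))) ≤ ENNReal.ofReal d) :
    hsENorm (ε ∘L (F * R)) ≤ ENNReal.ofReal (2 * c * d) := by
  have hfactor : ε ∘L (F * R) = (ε ∘L diagPow e u (-(1 / 2))) ∘L
      ((diagPow e u (1 / 2) * diagPow e' v (-(1 / 2))) * (diagPow e' v (1 / 2) * F * R)) := by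
    rw [mul_assoc, ← mul_assoc (diagPow e' v (-(1 / 2))), ← mul_assoc (diagPow e' v (-(1 / 2))),
      diagPow_neg_mul_self hl hv, one_mul, ContinuousLinearMap.comp_assoc,
      ← ContinuousLinearMap.mul_def, ← mul_assoc, diagPow_neg_mul_self hl hu, one_mul]
  have hhalf := norm_diagPow_mul_diagPow_neg_le hl hU hUh hu hv hη (θ := 1 / 2) (by norm_num)
    (by norm_num)
  rw [← Real.sqrt_eq_rpow] at hhalf
  have hres := norm_diagPow_mul_mul_le hl hU hUh hu hv hη hR hr hF (q := 1 / 2) hc fun j => by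
    rw [add_halves, Real.rpow_one, mul_comm, ← abs_of_pos (hl.trans_le (hv j).1), ← abs_mul]
    exact hf j
  rw [hfactor]
  refine (hsENorm_comp_le_ofReal hd hε (norm_mul_le_of_le hhalf hres)).trans_eq ?_
  congr 1
  linear_combination d * c * Real.mul_self_sqrt (zero_le_two (α := ℝ))

theorem hsENorm_comp_telescope_term_le (hl : 0 < l) (hU : IsDiag e u U) (hUh : IsDiag e' v Uh)
    (hu : ∀ i, u i ∈ Set.Icc l C) (hv : ∀ j, v j ∈ Set.Icc l C')
    (hη : ‖(U - Uh) * diagPow e u (-(1 / 2))‖ ≤ η) (hηl : η ≤ √l / 2)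
    (hR : IsDiag e r R) (hr : ∀ i, |r i| ≤ √(u i)) (hF : IsDiag e' f F)
    {Z : H →L[ℝ] Y} {θ c w : ℝ} {i j : ℕ} (hc : 0 ≤ c) (hw : 0 ≤ w)
    (hZ : hsENorm (Z ∘L diagPow e u (θ + i + j + 1)) ≤ ENNReal.ofReal w)
    (hf : ∀ k, |f k| * v k ^ (j + 1 / 2 : ℝ) ≤ c * l ^ (j + 1 / 2 : ℝ)) :
    hsENorm (Z ∘L (diagPow e u θ * (U ^ i * (U - Uh) * Uh ^ j) * (F * R))) ≤
      ENNReal.ofReal (√2 * c * (w * η)) := by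
  have hadj : ((U - Uh) ∘L diagPow e u (-(1 / 2))).adjoint =
      diagPow e u (-(1 / 2)) ∘L (U - Uh) := by
    rw [ContinuousLinearMap.adjoint_comp, (isDiag_diagPow hl hu _).adjoint_eq, map_sub,
      hU.adjoint_eq, hUh.adjoint_eq]
  have hdiff : ‖diagPow e u (-(1 / 2)) * (U - Uh)‖ ≤ η := by
    rwa [ContinuousLinearMap.mul_def, ← hadj, LinearIsometryEquiv.norm_map]
  have hfactor : Z ∘L (diagPow e u θ * (U ^ i * (U - Uh) * Uh ^ j) * (F * R)) =
      (Z ∘L diagPow e u (θ + i + j + 1)) ∘L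
        ((diagPow e u (-(j + 1 / 2)) * (diagPow e u (-(1 / 2)) * (U - Uh))) *
          (diagPow e' v j * F * R)) := by
    have hsplit : diagPow e u θ * U ^ i =
        diagPow e u (θ + i + j + 1) * diagPow e u (-(j + 1 / 2)) * diagPow e u (-(1 / 2)) := by
      rw [hU.pow_eq_diagPow hl hu, diagPow_mul hl hu, diagPow_mul hl hu, diagPow_mul hl hu]
      congr 1
      ring
    rw [ContinuousLinearMap.comp_assoc, ← ContinuousLinearMap.mul_def,
      ← hUh.pow_eq_diagPow hl hv]
    simp only [← mul_assoc, hsplit]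
  rw [hfactor]
  refine (hsENorm_comp_le_ofReal hw hZ (norm_mul_le_of_le
    (norm_mul_le_of_le (norm_diagPow_le hl hu (neg_nonpos.2 (by positivity))) hdiff)
    (norm_diagPow_mul_mul_le hl hU hUh hu hv (hη.trans hηl) hR hr hF (by positivity) hf))).trans_eq
      ?_
  congr 1
  rw [Real.rpow_neg hl.le]
  field_simp

theorem hsENorm_comp_diagPow_mul_pow_le (hl : 0 < l) (hU : IsDiag e u U) (hUh : IsDiag e' v Uh)
    (hu : ∀ i, u i ∈ Set.Icc l C) (hv : ∀ j, v j ∈ Set.Icc l C')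
    (hη : ‖(U - Uh) * diagPow e u (-(1 / 2))‖ ≤ √l / 2)
    (hR : IsDiag e r R) (hr : ∀ i, |r i| ≤ √(u i)) (hF : IsDiag e' f F)
    {Z : H →L[ℝ] Y} {θ c d : ℝ} {m : ℕ} (hc : 0 ≤ c) (hd : 0 ≤ d)
    (hZ : hsENorm Z ≤ ENNReal.ofReal d) (hθ0 : 0 ≤ θ) (hθ1 : θ ≤ 1)
    (hf : ∀ k, |f k| * v k ^ (θ + m + 1 / 2) ≤ c * l ^ (θ + m + 1 / 2)) :
    hsENorm (Z ∘L (diagPow e u θ * Uh ^ m * (F * R))) ≤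
      ENNReal.ofReal (√2 * c * (2 ^ θ * d * l ^ (θ + m + 1 / 2))) := by
  have hfactor : diagPow e u θ * Uh ^ m * (F * R) =
      (diagPow e u θ * diagPow e' v (-θ)) * (diagPow e' v (θ + m) * F * R) := by
    have hsplit : Uh ^ m = diagPow e' v (-θ) * diagPow e' v (θ + m) := by
      rw [hUh.pow_eq_diagPow hl hv, diagPow_mul hl hv, neg_add_cancel_left]
    rw [hsplit]
    simp only [mul_assoc]
  rw [hfactor]
  refine (hsENorm_comp_le_ofReal hd hZ (norm_mul_le_of_le
    (norm_diagPow_mul_diagPow_neg_le hl hU hUh hu hv hη hθ0 hθ1)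
    (norm_diagPow_mul_mul_le hl hU hUh hu hv hη hR hr hF (by positivity) hf))).trans_eq ?_
  congr 1
  ring

-- Heinz's inequality fails beyond exponent `1`, so the integer part of the exponent is moved from
-- `U` to `Uh` by the telescoping sum for `U ^ m - Uh ^ m`.
theorem hsENorm_comp_diagPow_mul_le (hl : 0 < l) (hU : IsDiag e u U) (hUh : IsDiag e' v Uh)
    (hu : ∀ i, u i ∈ Set.Icc l C) (hv : ∀ j, v j ∈ Set.Icc l C')
    (hη : ‖(U - Uh) * diagPow e u (-(1 / 2))‖ ≤ η) (hηl : η ≤ √l / 2)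
    (hR : IsDiag e r R) (hr : ∀ i, |r i| ≤ √(u i)) (hF : IsDiag e' f F)
    {Z : H →L[ℝ] Y} {θ c d w : ℝ} {m : ℕ} (hc : 0 ≤ c) (hd : 0 ≤ d) (hw : 0 ≤ w)
    (hZ : hsENorm Z ≤ ENNReal.ofReal d)
    (hW : hsENorm (Z ∘L diagPow e u (θ + m)) ≤ ENNReal.ofReal w) (hθ0 : 0 ≤ θ) (hθ1 : θ ≤ 1)
    (hf : ∀ j, ∀ p : ℝ, p ≤ θ + m + 1 / 2 → |f j| * v j ^ p ≤ c * l ^ p) :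
    hsENorm ((Z ∘L diagPow e u (θ + m)) ∘L (F * R)) ≤
      ENNReal.ofReal (√2 * c * (m * (w * η) + 2 ^ θ * d * l ^ (θ + m + 1 / 2))) := by
  have hη0 : 0 ≤ η := (norm_nonneg _).trans hη
  have hdecomp : (Z ∘L diagPow e u (θ + m)) ∘L (F * R) =
      ∑ j ∈ Finset.range m,
        Z ∘L (diagPow e u θ * (U ^ (m - 1 - j) * (U - Uh) * Uh ^ j) * (F * R)) +
      Z ∘L (diagPow e u θ * Uh ^ m * (F * R)) := by
    have hpow : diagPow e u (θ + m) = diagPow e u θ *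
        ∑ j ∈ Finset.range m, U ^ (m - 1 - j) * (U - Uh) * Uh ^ j + diagPow e u θ * Uh ^ m := by
      rw [← pow_sub_pow_eq_sum, ← mul_add, sub_add_cancel, hU.pow_eq_diagPow hl hu,
        diagPow_mul hl hu]
    rw [ContinuousLinearMap.comp_assoc, ← ContinuousLinearMap.mul_def, hpow, add_mul,
      ContinuousLinearMap.comp_add, Finset.mul_sum, Finset.sum_mul,
      ContinuousLinearMap.comp_finsetSum]
  have hterm : ∀ j ∈ Finset.range m,
      hsENorm (Z ∘L (diagPow e u θ * (U ^ (m - 1 - j) * (U - Uh) * Uh ^ j) * (F * R))) ≤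
        ENNReal.ofReal (√2 * c * (w * η)) := fun j hj => by
    have hm : ((m - 1 - j : ℕ) : ℝ) + j + 1 = m := by
      have := Finset.mem_range.1 hj
      exact_mod_cast (by omega : m - 1 - j + j + 1 = m)
    have : (j : ℝ) ≤ m := by exact_mod_cast (Finset.mem_range.1 hj).le
    refine hsENorm_comp_telescope_term_le hl hU hUh hu hv hη hηl hR hr hF hc hw ?_
      fun k => hf k _ (by linarith)
    rwa [add_assoc, add_assoc, ← add_assoc _ (j : ℝ), hm]
  rw [hdecomp]
  refine (hsENorm_add_le _ _).trans ((add_le_add ((hsENorm_sum_le _ _).trans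
    (Finset.sum_le_sum hterm)) (hsENorm_comp_diagPow_mul_pow_le hl hU hUh hu hv (hη.trans hηl) hR
      hr hF hc hd hZ hθ0 hθ1 fun k => hf k _ le_rfl)).trans_eq ?_)
  rw [Finset.sum_const, Finset.card_range, nsmul_eq_mul, ← ENNReal.ofReal_natCast,
    ← ENNReal.ofReal_mul (by positivity), ← ENNReal.ofReal_add (by positivity) (by positivity)]
  congr 1
  ring

end Comparison

/-! ### Deviation of the empirical operators -/

section Deviation

/-- `β` is a density of the target measure `qX` with respect to the source measure `pX` and takes
its values in `[0, b]`. -/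
structure IsBoundedDensity {X : Type*} [MeasurableSpace X] (β : X → ℝ) (b : ℝ)
    (pX qX : Measure X) : Prop where
  measurable : Measurable β
  nonneg : ∀ x, 0 ≤ β x
  le : ∀ x, β x ≤ b
  eq_withDensity : qX = pX.withDensity fun x => ENNReal.ofReal (β x)

section Integrals

variable {X Y V : Type*} [MeasurableSpace X] [MeasurableSpace Y]
  [NormedAddCommGroup V] [NormedSpace ℝ V] {pX qX : Measure X} {β : X → ℝ} {b : ℝ}

theorem IsBoundedDensity.integral_smul (hβ : IsBoundedDensity β b pX qX) (f : X → V) :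
    ∫ x, β x • f x ∂pX = ∫ x, f x ∂qX := by
  rw [hβ.eq_withDensity, integral_withDensity_eq_integral_toReal_smul hβ.measurable.ennreal_ofReal
    (.of_forall fun x => ENNReal.ofReal_lt_top)]
  simp only [ENNReal.toReal_ofReal (hβ.nonneg _)]

theorem IsBoundedDensity.one_le [IsProbabilityMeasure pX] [IsProbabilityMeasure qX]
    (hβ : IsBoundedDensity β b pX qX) : 1 ≤ b := by
  rw [← ENNReal.one_le_ofReal]
  calc 1 = ∫⁻ x, ENNReal.ofReal (β x) ∂pX := by
        rw [← setLIntegral_univ, ← withDensity_apply _ MeasurableSet.univ, ← hβ.eq_withDensity,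
          measure_univ]
    _ ≤ ∫⁻ _, ENNReal.ofReal b ∂pX :=
        lintegral_mono fun x => ENNReal.ofReal_le_ofReal (hβ.le x)
    _ = ENNReal.ofReal b := by rw [lintegral_const, measure_univ, mul_one]

theorem integral_fst_compProd [SFinite pX] {K : Kernel X Y} [IsMarkovKernel K] {f : X → V}
    (hf : StronglyMeasurable f) : ∫ z, f z.1 ∂(pX ⊗ₘ K) = ∫ x, f x ∂pX := by
  rw [← integral_map measurable_fst.aemeasurable hf.aestronglyMeasurable]
  exact congrArg (fun μ => ∫ x, f x ∂μ) (Measure.fst_compProd pX K)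

theorem exists_measurableSet_of_measure_le {Ω : Type*} [MeasurableSpace Ω] {μ : Measure Ω}
    [IsProbabilityMeasure μ] {B : Set Ω} {δ : ℝ} (hδ : 0 ≤ δ) (hB : μ B ≤ ENNReal.ofReal δ) :
    ∃ E, MeasurableSet E ∧ ENNReal.ofReal (1 - δ) ≤ μ E ∧ ∀ z ∈ E, z ∉ B := by
  refine ⟨(toMeasurable μ B)ᶜ, (measurableSet_toMeasurable μ B).compl, ?_,
    fun z hz hzB => hz (subset_toMeasurable μ B hzB)⟩
  rw [prob_compl_eq_one_sub (measurableSet_toMeasurable μ B), measure_toMeasurable,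
    ENNReal.ofReal_sub _ hδ, ENNReal.ofReal_one]
  exact tsub_le_tsub_left hB _

theorem integral_lp_apply {ι V : Type*} [NormedAddCommGroup V] [InnerProductSpace ℝ V]
    [CompleteSpace V] {F : X → lp (fun _ : ι => V) 2} {μ : Measure X} (hF : Integrable F μ)
    (i : ι) :
    (∫ x, F x ∂μ) i = ∫ x, F x i ∂μ :=
  ((lp.evalCLM ℝ (fun _ : ι => V) 2 i).integral_comp_comm hF).symm

end Integrals

section Tensor

variable {ι X Y H V : Type*} [NormedAddCommGroup H] [InnerProductSpace ℝ H]
  [NormedAddCommGroup V] [InnerProductSpace ℝ V]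

/-- The Hilbert-Schmidt operator `v(x, y) ⊗ u(x)` attached to an observation `(x, y)`, as an element
of `ℓ²(ι, V)`. The operators to be estimated are averages of such tensors. -/
def sampleTensor (e : HilbertBasis ι ℝ H) (v : X × Y → V) (u : X → H) (z : X × Y) :
    lp (fun _ : ι => V) 2 :=
  hsTensor e (v z) (u z.1)

variable (e : HilbertBasis ι ℝ H) {u : X → H} {v : X × Y → V}

theorem average_sampleTensor_apply {n : ℕ} (z : Fin n → X × Y) (i : ι) :
    ((1 / n : ℝ) • ∑ j, sampleTensor e v u (z j)) i =
      (1 / n : ℝ) • ∑ j, ⟪e i, u (z j).1⟫_ℝ • v (z j) := by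
  rw [lp.coeFn_smul, Pi.smul_apply, lp.coeFn_sum, Finset.sum_apply]
  rfl

variable [MeasurableSpace X] [MeasurableSpace Y] {pX qX : Measure X} {K : Kernel X Y}
  {β : X → ℝ} {b L M : ℝ}

theorem stronglyMeasurable_sampleTensor (hv : StronglyMeasurable v) (hu : StronglyMeasurable u) :
    StronglyMeasurable (sampleTensor e v u) :=
  have hcont : Continuous fun p : V × H => hsTensor e p.1 p.2 :=
    ((hsTensor e).continuous.comp continuous_fst).clm_apply continuous_snd
  hcont.comp_stronglyMeasurable (hv.prodMk (hu.comp_measurable measurable_fst))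

theorem norm_sampleTensor_le (hβ : IsBoundedDensity β b pX qX) (hM : 0 ≤ M) (hL : ∀ x, ‖u x‖ ≤ L)
    (hvM : ∀ᵐ z ∂(pX ⊗ₘ K), ‖v z‖ ≤ β z.1 * M) :
    ∀ᵐ z ∂(pX ⊗ₘ K), ‖sampleTensor e v u z‖ ≤ b * M * L := by
  filter_upwards [hvM] with z hz
  have hb : 0 ≤ b := (hβ.nonneg z.1).trans (hβ.le z.1)
  rw [sampleTensor, norm_hsTensor]
  exact mul_le_mul (hz.trans (mul_le_mul_of_nonneg_right (hβ.le _) hM)) (hL _) (norm_nonneg _)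
    (by positivity)

variable [IsProbabilityMeasure pX] [IsMarkovKernel K]

theorem integral_norm_sampleTensor_sq_le (hβ : IsBoundedDensity β b pX qX)
    (hu : StronglyMeasurable u) (hL : ∀ x, ‖u x‖ ≤ L)
    (hvM : ∀ᵐ z ∂(pX ⊗ₘ K), ‖v z‖ ≤ β z.1 * M) :
    ∫ z, ‖sampleTensor e v u z‖ ^ 2 ∂(pX ⊗ₘ K) ≤ b * M ^ 2 * ∫ x, ‖u x‖ ^ 2 ∂qX := by
  have hf : StronglyMeasurable fun x : X => β x • ‖u x‖ ^ 2 :=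
    hβ.measurable.stronglyMeasurable.smul (hu.norm.pow 2)
  rw [← hβ.integral_smul, ← integral_fst_compProd (K := K) hf, ← integral_const_mul]
  refine integral_mono_of_nonneg (.of_forall fun z => sq_nonneg _) ?_ ?_
  · refine Integrable.const_mul (Integrable.of_bound (C := b * L ^ 2)
      (hf.comp_measurable measurable_fst).aestronglyMeasurable (.of_forall fun z => ?_)) _
    change ‖β z.1 • ‖u z.1‖ ^ 2‖ ≤ _
    rw [norm_smul, norm_pow, norm_norm, Real.norm_of_nonneg (hβ.nonneg _)]
    exact mul_le_mul (hβ.le _) (pow_le_pow_left₀ (norm_nonneg _) (hL _) 2) (sq_nonneg _)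
      ((hβ.nonneg z.1).trans (hβ.le z.1))
  · filter_upwards [hvM] with z hz
    have hβ0 := hβ.nonneg z.1
    calc ‖sampleTensor e v u z‖ ^ 2 ≤ (β z.1 * M * ‖u z.1‖) ^ 2 := by
          rw [sampleTensor, norm_hsTensor]
          gcongr
      _ = β z.1 * (β z.1 * (M ^ 2 * ‖u z.1‖ ^ 2)) := by ring
      _ ≤ b * (β z.1 * (M ^ 2 * ‖u z.1‖ ^ 2)) := by
          gcongr
          exact hβ.le _
      _ = b * M ^ 2 * (β z.1 • ‖u z.1‖ ^ 2) := by rw [smul_eq_mul]; ring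

variable [CompleteSpace V]

theorem measure_pi_norm_average_sampleTensor_sub_integral (hβ : IsBoundedDensity β b pX qX)
    (hv : StronglyMeasurable v) (hu : StronglyMeasurable u) (hM : 0 ≤ M) (hL : ∀ x, ‖u x‖ ≤ L)
    (hvM : ∀ᵐ z ∂(pX ⊗ₘ K), ‖v z‖ ≤ β z.1 * M) {n : ℕ} (hn : n ≠ 0) {a t : ℝ} (ha : 2 ≤ a)
    (ht : 0 < t) :
    (Measure.pi fun _ : Fin n => pX ⊗ₘ K)
        {z | a * M * (2 * b * L / n + √(b * (∫ x, ‖u x‖ ^ 2 ∂qX) / n)) * t <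
          ‖(1 / n : ℝ) • ∑ i, sampleTensor e v u (z i) -
            ∫ z, sampleTensor e v u z ∂(pX ⊗ₘ K)‖} ≤
      ENNReal.ofReal (min (2 * Real.exp (1 - 2 * t)) (1 / (a * t) ^ 2)) := by
  obtain ⟨x⟩ := pX.nonempty_of_neZero
  have hb : 0 ≤ b := (hβ.nonneg x).trans (hβ.le x)
  have hL0 : 0 ≤ L := (norm_nonneg _).trans (hL x)
  have : 0 ≤ ∫ x, ‖u x‖ ^ 2 ∂qX := integral_nonneg fun x => sq_nonneg _
  have hvar : ∫ z, ‖sampleTensor e v u z‖ ^ 2 ∂(pX ⊗ₘ K) ≤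
      (M * √(b * ∫ x, ‖u x‖ ^ 2 ∂qX)) ^ 2 := by
    refine (integral_norm_sampleTensor_sq_le e hβ hu hL hvM).trans_eq ?_
    rw [mul_pow, Real.sq_sqrt (by positivity)]
    ring
  convert measure_pi_norm_average_sub_integral (stronglyMeasurable_sampleTensor e hv hu)
    (by positivity) (norm_sampleTensor_le e hβ hM hL hvM) (by positivity) hvar hn ha ht using 5
  rw [Real.sqrt_div (by positivity)]
  ring

end Tensor

section EmpiricalOperators

variable {ι X H Y : Type*} [MeasurableSpace X] [NormedAddCommGroup H] [InnerProductSpace ℝ H]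
  [CompleteSpace H] [RKHS ℝ H X ℝ] [MeasurableSpace Y]
  {pX qX : Measure X} [IsProbabilityMeasure pX] {K : Kernel X Y} [IsMarkovKernel K]
  {β : X → ℝ} {b κ L : ℝ} {n : ℕ} {S : H →L[ℝ] H}

theorem hsENorm_empCovOp_sub_covOp_comp (hβ : IsBoundedDensity β b pX qX)
    (hφ : StronglyMeasurable (featureMap H : X → H)) (hφ2 : MemLp (featureMap H : X → H) 2 qX)
    (e : HilbertBasis ι ℝ H) (hS : S.IsSymmetric)
    (hint : Integrable (sampleTensor e (fun z => β z.1 • featureMap H z.1)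
      (fun x => S (featureMap H x))) (pX ⊗ₘ K)) (z : Fin n → X × Y) :
    hsENorm ((empCovOp H β z - covOp H qX) ∘L S) = ENNReal.ofReal
      ‖(1 / n : ℝ) • ∑ i, sampleTensor e (fun z => β z.1 • featureMap H z.1)
          (fun x => S (featureMap H x)) (z i) -
        ∫ z, sampleTensor e (fun z => β z.1 • featureMap H z.1)
          (fun x => S (featureMap H x)) z ∂(pX ⊗ₘ K)‖ := by
  refine hsENorm_eq_ofReal_norm_lp e fun i => ?_
  have hcoord : ∀ x : X, ⟪e i, S (featureMap H x)⟫_ℝ = ⟪featureMap H x, S (e i)⟫_ℝ := fun x =>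
    (hS (e i) (featureMap H x)).symm.trans (real_inner_comm _ _)
  have hm : StronglyMeasurable fun x : X =>
      ⟪featureMap H x, S (e i)⟫_ℝ • β x • (featureMap H x : H) :=
    (hφ.inner stronglyMeasurable_const).smul (hβ.measurable.stronglyMeasurable.smul hφ)
  rw [lp.coeFn_sub, Pi.sub_apply, average_sampleTensor_apply, integral_lp_apply hint]
  simp only [sampleTensor, hsTensor_apply, hcoord]
  rw [integral_fst_compProd hm]
  simp only [smul_comm _ (β _)]
  rw [hβ.integral_smul, ← covOp_apply hφ2]
  simp [empCovOp]

theorem measure_pi_hsENorm_empCovOp_sub_covOp_comp [IsProbabilityMeasure qX]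
    (hβ : IsBoundedDensity β b pX qX) (hφ : StronglyMeasurable (featureMap H : X → H))
    (hκ : ∀ x, ‖(featureMap H x : H)‖ ≤ κ) (hS : S.IsSymmetric)
    (hL : ∀ x : X, ‖S (featureMap H x)‖ ≤ L) (hn : n ≠ 0) {a t : ℝ} (ha : 2 ≤ a) (ht : 0 < t) :
    (Measure.pi fun _ : Fin n => pX ⊗ₘ K)
        {z | ENNReal.ofReal
          (a * κ * (2 * b * L / n + √(b * (∫ x, ‖S (featureMap H x)‖ ^ 2 ∂qX) / n)) * t) <
            hsENorm ((empCovOp H β z - covOp H qX) ∘L S)} ≤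
      ENNReal.ofReal (min (2 * Real.exp (1 - 2 * t)) (1 / (a * t) ^ 2)) := by
  obtain ⟨x⟩ := pX.nonempty_of_neZero
  have hκ0 : 0 ≤ κ := (norm_nonneg _).trans (hκ x)
  have hv : StronglyMeasurable fun z : X × Y => β z.1 • (featureMap H z.1 : H) :=
    (hβ.measurable.stronglyMeasurable.smul hφ).comp_measurable measurable_fst
  have hu : StronglyMeasurable fun x : X => S (featureMap H x) :=
    S.continuous.comp_stronglyMeasurable hφ
  have hvM : ∀ᵐ z ∂(pX ⊗ₘ K), ‖β z.1 • (featureMap H z.1 : H)‖ ≤ β z.1 * κ := .of_forall fun z => by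
    rw [norm_smul, Real.norm_of_nonneg (hβ.nonneg _)]
    exact mul_le_mul_of_nonneg_left (hκ _) (hβ.nonneg _)
  have hφ2 : MemLp (featureMap H : X → H) 2 qX :=
    .of_bound hφ.aestronglyMeasurable κ (.of_forall hκ)
  have hint := Integrable.of_bound
    (stronglyMeasurable_sampleTensor (someBasis H) hv hu).aestronglyMeasurable (b * κ * L)
    (norm_sampleTensor_le (someBasis H) hβ hκ0 hL hvM)
  simp only [hsENorm_empCovOp_sub_covOp_comp hβ hφ hφ2 _ hS hint]
  refine (measure_mono fun z hz => ?_).trans (measure_pi_norm_average_sampleTensor_sub_integral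
    (someBasis H) hβ hv hu hκ0 hL hvM hn ha ht)
  exact (ENNReal.ofReal_lt_ofReal_iff'.1 hz).1

variable [NormedAddCommGroup Y] [InnerProductSpace ℝ Y] [CompleteSpace Y] {M' : ℝ}

omit [MeasurableSpace X] [MeasurableSpace Y] in
theorem hsENorm_residual_comp (e : HilbertBasis ι ℝ H) (hS : S.IsSymmetric) (W : H →L[ℝ] Y)
    (z : Fin n → X × Y) :
    hsENorm ((empCrossCovOp H β z - W ∘L empCovOp H β z) ∘L S) = ENNReal.ofReal
      ‖(1 / n : ℝ) • ∑ i, sampleTensor e (fun z => β z.1 • (z.2 - W (featureMap H z.1)))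
        (fun x => S (featureMap H x)) (z i)‖ := by
  refine hsENorm_eq_ofReal_norm_lp e fun i => ?_
  have hcoord : ∀ x : X, ⟪e i, S (featureMap H x)⟫_ℝ = ⟪featureMap H x, S (e i)⟫_ℝ := fun x =>
    (hS (e i) (featureMap H x)).symm.trans (real_inner_comm _ _)
  rw [average_sampleTensor_apply]
  simp only [hcoord, smul_comm _ (β _), smul_sub, Finset.sum_sub_distrib]
  simp [empCovOp, empCrossCovOp]

omit [CompleteSpace H] [RKHS ℝ H X ℝ] in
theorem integral_sampleTensor_residual_eq_zero [BorelSpace Y] [SecondCountableTopology Y]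
    (hβ : IsBoundedDensity β b pX qX) (hM' : ∀ᵐ z ∂(pX ⊗ₘ K), ‖z.2‖ ≤ M') {f : X → Y}
    (hreg : ∀ᵐ x ∂qX, regressionFun K x = f x) (e : HilbertBasis ι ℝ H) {u : X → H}
    (hint : Integrable (sampleTensor e (fun z => β z.1 • (z.2 - f z.1)) u) (pX ⊗ₘ K)) :
    ∫ z, sampleTensor e (fun z => β z.1 • (z.2 - f z.1)) u z ∂(pX ⊗ₘ K) = 0 := by
  have hinner : ∀ᵐ x ∂pX,
      ∫ y, sampleTensor e (fun z => β z.1 • (z.2 - f z.1)) u (x, y) ∂(K x) =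
        β x • hsTensor e (regressionFun K x - f x) (u x) := by
    filter_upwards [Measure.ae_ae_of_ae_compProd hM'] with x hx
    have hid : Integrable (fun y : Y => y) (K x) :=
      .of_bound stronglyMeasurable_id.aestronglyMeasurable M' hx
    have hsub : Integrable (fun y : Y => y - f x) (K x) := hid.sub (integrable_const _)
    have h := (ContinuousLinearMap.flip (hsTensor (Y := Y) e) (u x)).integral_comp_comm
      (hsub.smul (β x))
    simp only [ContinuousLinearMap.flip_apply, Pi.smul_apply] at h
    simp only [sampleTensor]
    rw [h, integral_smul, integral_sub hid (integrable_const _), integral_const, probReal_univ,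
      one_smul, map_smul]
    rfl
  rw [Measure.integral_compProd hint, integral_congr_ae hinner, hβ.integral_smul]
  refine integral_eq_zero_of_ae ?_
  filter_upwards [hreg] with x hx
  rw [hx, sub_self, map_zero]
  rfl

theorem measure_pi_hsENorm_residual_comp [BorelSpace Y]
    [SecondCountableTopology Y] (hβ : IsBoundedDensity β b pX qX)
    (hφ : StronglyMeasurable (featureMap H : X → H)) {W : H →L[ℝ] Y} {w : ℝ}
    (hW : ∀ x : X, ‖W (featureMap H x)‖ ≤ w) (hM' : ∀ᵐ z ∂(pX ⊗ₘ K), ‖z.2‖ ≤ M')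
    (hreg : ∀ᵐ x ∂qX, regressionFun K x = W (featureMap H x)) (hS : S.IsSymmetric)
    (hL : ∀ x : X, ‖S (featureMap H x)‖ ≤ L) (hn : n ≠ 0) {a t : ℝ} (ha : 2 ≤ a) (ht : 0 < t) :
    (Measure.pi fun _ : Fin n => pX ⊗ₘ K)
        {z | ENNReal.ofReal
          (a * (M' + w) * (2 * b * L / n + √(b * (∫ x, ‖S (featureMap H x)‖ ^ 2 ∂qX) / n)) * t) <
            hsENorm ((empCrossCovOp H β z - W ∘L empCovOp H β z) ∘L S)} ≤
      ENNReal.ofReal (min (2 * Real.exp (1 - 2 * t)) (1 / (a * t) ^ 2)) := by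
  obtain ⟨z₀, hz₀⟩ := hM'.exists
  have hM0 : 0 ≤ M' + w := add_nonneg ((norm_nonneg _).trans hz₀)
    ((norm_nonneg _).trans (hW z₀.1))
  have hv : StronglyMeasurable fun z : X × Y => β z.1 • (z.2 - W (featureMap H z.1)) :=
    (hβ.measurable.comp measurable_fst).stronglyMeasurable.smul
      (measurable_snd.stronglyMeasurable.sub
        (W.continuous.comp_stronglyMeasurable (hφ.comp_measurable measurable_fst)))
  have hu : StronglyMeasurable fun x : X => S (featureMap H x) :=
    S.continuous.comp_stronglyMeasurable hφ
  have hvM : ∀ᵐ z ∂(pX ⊗ₘ K), ‖β z.1 • (z.2 - W (featureMap H z.1))‖ ≤ β z.1 * (M' + w) := by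
    filter_upwards [hM'] with z hz
    rw [norm_smul, Real.norm_of_nonneg (hβ.nonneg _)]
    exact mul_le_mul_of_nonneg_left ((norm_sub_le _ _).trans (add_le_add hz (hW _)))
      (hβ.nonneg _)
  have hint := Integrable.of_bound
    (stronglyMeasurable_sampleTensor (someBasis H) hv hu).aestronglyMeasurable (b * (M' + w) * L)
    (norm_sampleTensor_le (someBasis H) hβ hM0 hL hvM)
  have hmean := integral_sampleTensor_residual_eq_zero hβ hM' hreg (someBasis H) hint
  have hdev := measure_pi_norm_average_sampleTensor_sub_integral (someBasis H) hβ hv hu hM0 hL hvM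
    hn ha ht
  simp only [hmean, sub_zero] at hdev
  simp only [hsENorm_residual_comp (someBasis H) hS]
  refine (measure_mono fun z hz => ?_).trans hdev
  exact (ENNReal.ofReal_lt_ofReal_iff'.1 hz).1

theorem exists_measurableSet_hsENorm_deviation_le [IsProbabilityMeasure qX] [BorelSpace Y]
    [SecondCountableTopology Y] (hβ : IsBoundedDensity β b pX qX)
    (hφ : StronglyMeasurable (featureMap H : X → H)) (hκ : ∀ x, ‖(featureMap H x : H)‖ ≤ κ)
    {W : H →L[ℝ] Y} {w : ℝ} (hW : ∀ x : X, ‖W (featureMap H x)‖ ≤ w)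
    (hM' : ∀ᵐ z ∂(pX ⊗ₘ K), ‖z.2‖ ≤ M')
    (hreg : ∀ᵐ x ∂qX, regressionFun K x = W (featureMap H x)) (hS : S.IsSymmetric)
    (hL : ∀ x : X, ‖S (featureMap H x)‖ ≤ L) (hn : n ≠ 0) {δ : ℝ} (hδ0 : 0 < δ) (hδ1 : δ < 1) :
    ∃ E : Set (Fin n → X × Y), MeasurableSet E ∧
      ENNReal.ofReal (1 - δ) ≤ Measure.pi (fun _ : Fin n => pX ⊗ₘ K) E ∧
      ∀ z ∈ E,
        hsENorm ((empCovOp H β z - covOp H qX) ∘L S) ≤ ENNReal.ofReal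
          (2 * κ * (2 * b * L / n + √(b * (∫ x, ‖S (featureMap H x)‖ ^ 2 ∂qX) / n)) *
            Real.log (2 / δ)) ∧
        hsENorm ((empCrossCovOp H β z - W ∘L empCovOp H β z) ∘L S) ≤ ENNReal.ofReal
          (5 / 2 * (M' + w) * (2 * b * L / n + √(b * (∫ x, ‖S (featureMap H x)‖ ^ 2 ∂qX) / n)) *
            Real.log (2 / δ)) := by
  have ht : 0 < Real.log (2 / δ) := Real.log_pos (by rw [lt_div_iff₀ hδ0]; linarith)
  have h1 := measure_pi_hsENorm_empCovOp_sub_covOp_comp (K := K) hβ hφ hκ hS hL hn le_rfl ht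
  have h2 := measure_pi_hsENorm_residual_comp hβ hφ hW hM' hreg hS hL hn (a := 5 / 2)
    (by norm_num) ht
  have h := (measure_union_le _ _).trans (add_le_add h1 h2)
  rw [← ENNReal.ofReal_add (by positivity) (by positivity)] at h
  obtain ⟨E, hE, hEδ, hbound⟩ := exists_measurableSet_of_measure_le hδ0.le
    (h.trans (ENNReal.ofReal_le_ofReal (min_add_min_le hδ0 hδ1)))
  exact ⟨E, hE, hEδ, fun z hz =>
    ⟨not_lt.1 fun hlt => hbound z hz (.inl hlt), not_lt.1 fun hlt => hbound z hz (.inr hlt)⟩⟩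

end EmpiricalOperators

end Deviation

/-! ### The error bound -/

section SpectralData

variable {ι H : Type*} [NormedAddCommGroup H] [InnerProductSpace ℝ H] {e : HilbertBasis ι ℝ H}
  {a : ι → ℝ} {A : H →L[ℝ] H} {s lam : ℝ}

theorem exists_hilbertBasis_isDiag_mem_Icc.{u} {H : Type u} [NormedAddCommGroup H]
    [InnerProductSpace ℝ H] [CompleteSpace H] {A : H →L[ℝ] H} (hc : IsCompactOperator A)
    (hpos : A.IsPositive) (hA : ‖A‖ ≤ s) :
    ∃ (ι : Type u) (e : HilbertBasis ι ℝ H) (a : ι → ℝ),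
      IsDiag e a A ∧ ∀ i, a i ∈ Set.Icc 0 s := by
  obtain ⟨ι, e, a, ha⟩ := exists_hilbertBasis_isDiag hc hpos.isSymmetric
  exact ⟨ι, e, a, ha, ha.eigenvalue_mem_Icc hpos hA⟩

theorem IsDiag.add_smul_one (hA : IsDiag e a A) (lam : ℝ) :
    IsDiag e (fun i => a i + lam) (A + lam • (1 : H →L[ℝ] H)) :=
  (hA.add (IsDiag.one.smul lam)).congr fun i => by rw [mul_one]

theorem add_mem_Icc_of_mem_Icc_zero (ha : ∀ i, a i ∈ Set.Icc 0 s) (i : ι) :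
    a i + lam ∈ Set.Icc lam (s + lam) :=
  ⟨le_add_of_nonneg_left (ha i).1, add_le_add_left (ha i).2 lam⟩

theorem isDiag_diagOp_sqrt (e : HilbertBasis ι ℝ H) (ha : ∀ i, a i ∈ Set.Icc 0 s) :
    IsDiag e (fun i => √(a i)) (diagOp e fun i => √(a i)) :=
  isDiag_diagOp e (C := √s) fun i => by
    rw [abs_of_nonneg (Real.sqrt_nonneg _)]
    exact Real.sqrt_le_sqrt (ha i).2

theorem IsDiag.diagOp_sqrt_mul_self (hA : IsDiag e a A) (ha : ∀ i, a i ∈ Set.Icc 0 s) :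
    (diagOp e fun i => √(a i)) * (diagOp e fun i => √(a i)) = A :=
  ((isDiag_diagOp_sqrt e ha).mul (isDiag_diagOp_sqrt e ha)).unique
    (hA.congr fun i => (Real.mul_self_sqrt (ha i).1).symm)

theorem integral_norm_diagPow_featureMap_sq {X : Type*} [MeasurableSpace X] [CompleteSpace H]
    [TopologicalSpace.SeparableSpace H] [RKHS ℝ H X ℝ] {qX : Measure X}
    (hφ : MemLp (featureMap H : X → H) 2 qX) (hA : IsDiag e a (covOp H qX))
    (ha : ∀ i, a i ∈ Set.Icc 0 s) (hlam : 0 < lam) :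
    ∫ x, ‖diagPow e (fun i => a i + lam) (-(1 / 2)) (featureMap H x)‖ ^ 2 ∂qX =
      effDim (covOp H qX) lam := by
  refine hA.integral_norm_apply_featureMap_sq hφ (isDiag_diagOp_sqrt e ha)
    (hA.diagOp_sqrt_mul_self ha) (isDiag_diagPow hlam (add_mem_Icc_of_mem_Icc_zero ha) _)
    fun i => ?_
  have hpos : 0 < a i + lam := add_pos_of_nonneg_of_pos (ha i).1 hlam
  rw [← Real.rpow_add hpos, show (-(1 / 2) + -(1 / 2) : ℝ) = -1 by norm_num, Real.rpow_neg_one,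
    mul_inv_cancel₀ hpos.ne']

theorem IsRegularizationFamily.isDiag_diagOp {g : ℝ → ℝ → ℝ} {D B γ : ℝ}
    (hg : IsRegularizationFamily g s D B γ) (hlam : lam ∈ Set.Ioc 0 s) (e : HilbertBasis ι ℝ H)
    (ha : ∀ i, a i ∈ Set.Icc 0 s) :
    IsDiag e (fun i => g lam (a i)) (diagOp e fun i => g lam (a i)) := by
  refine CovariateShift.isDiag_diagOp e (C := |g lam 0| + B / lam) fun i => ?_
  have hB : 0 ≤ B / lam := div_nonneg hg.B_pos.le hlam.1.le
  rcases (ha i).1.eq_or_lt with h | h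
  · rw [← h]
    exact le_add_of_nonneg_right hB
  · exact (hg.abs_le lam hlam _ ⟨h, (ha i).2⟩).trans (le_add_of_nonneg_left (abs_nonneg _))

theorem IsIndexFunction.isDiag_diagOp {φ : ℝ → ℝ} (hφ : IsIndexFunction φ)
    (e : HilbertBasis ι ℝ H) (ha : ∀ i, a i ∈ Set.Icc 0 s) :
    IsDiag e (fun i => φ (a i)) (diagOp e fun i => φ (a i)) := by
  refine CovariateShift.isDiag_diagOp e (C := φ s) fun i => ?_
  rw [abs_of_nonneg (hφ.nonneg (ha i).1)]
  exact hφ.strictMonoOn.monotoneOn (ha i).1 ((ha i).1.trans (ha i).2) (ha i).2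

end SpectralData

section Error

variable {ι κ H Y : Type*} [Countable ι] [Countable κ] [NormedAddCommGroup H]
  [InnerProductSpace ℝ H] [CompleteSpace H] [NormedAddCommGroup Y] [InnerProductSpace ℝ Y]
  [CompleteSpace Y] {e : HilbertBasis ι ℝ H} {e' : HilbertBasis κ ℝ H} {a : ι → ℝ} {a' : κ → ℝ}
  {T Th R G : H →L[ℝ] H} {W Co : H →L[ℝ] Y} {g : ℝ → ℝ → ℝ} {φ : ℝ → ℝ}
  {s D B γ ν γν c lam η d w co : ℝ} {m : ℕ}

-- On the kernel of `Th`, where `g lam 0` is not controlled, `ε` vanishes.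
theorem IsRegularizationFamily.hsENorm_sample_error_le (hg : IsRegularizationFamily g s D B γ)
    (hlam : lam ∈ Set.Ioc 0 s) (hT : IsDiag e a T) (hTh : IsDiag e' a' Th)
    (ha : ∀ i, a i ∈ Set.Icc 0 s) (ha' : ∀ j, a' j ∈ Set.Icc 0 s)
    (hη : ‖(T - Th) * diagPow e (fun i => a i + lam) (-(1 / 2))‖ ≤ √lam / 2)
    (hR : IsDiag e (fun i => √(a i)) R) (hG : IsDiag e' (fun j => g lam (a' j)) G)
    {ε : H →L[ℝ] Y} (hker : ∀ u, Th u = 0 → ε u = 0) (hd : 0 ≤ d)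
    (hε : hsENorm (ε ∘L diagPow e (fun i => a i + lam) (-(1 / 2))) ≤ ENNReal.ofReal d) :
    hsENorm (ε ∘L (G * R)) ≤ ENNReal.ofReal (2 * (B + D) * d) := by
  have hB := hg.B_pos
  have hD := hg.D_pos
  have hl := hlam.1
  set f : κ → ℝ := fun j => if a' j = 0 then 0 else g lam (a' j)
  have hf_of_ne : ∀ j, a' j ≠ 0 → a' j ∈ Set.Ioc 0 s := fun j hj =>
    ⟨(ha' j).1.lt_of_ne' hj, (ha' j).2⟩
  have hF : IsDiag e' f (diagOp e' f) := CovariateShift.isDiag_diagOp e' (C := B / lam) fun j => by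
    by_cases hj : a' j = 0
    · simp only [f, hj, if_true, abs_zero]
      positivity
    · simp only [f, hj, if_false]
      exact hg.abs_le lam hlam _ (hf_of_ne j hj)
  have hεG : ε ∘L G = ε ∘L diagOp e' f := eq_of_apply_hilbertBasis_eq e' fun j => by
    simp only [ContinuousLinearMap.comp_apply, hG j, hF j, map_smul, f]
    split_ifs with hj
    · rw [hker (e' j) (by rw [hTh j, hj, zero_smul]), smul_zero, smul_zero]
    · rfl
  rw [ContinuousLinearMap.mul_def, ← ContinuousLinearMap.comp_assoc, hεG,
    ContinuousLinearMap.comp_assoc, ← ContinuousLinearMap.mul_def]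
  refine hsENorm_comp_mul_le hl (hT.add_smul_one lam) (hTh.add_smul_one lam)
    (add_mem_Icc_of_mem_Icc_zero ha) (add_mem_Icc_of_mem_Icc_zero ha')
    (by rwa [add_sub_add_right_eq_sub]) hR (fun i => ?_) hF (by positivity) (fun j => ?_) hd hε
  · rw [abs_of_nonneg (Real.sqrt_nonneg _)]
    exact Real.sqrt_le_sqrt (le_add_of_nonneg_right hl.le)
  · by_cases hj : a' j = 0
    · simp only [f, hj, if_true, mul_zero, abs_zero]
      positivity
    · simp only [f, hj, if_false]
      exact hg.abs_add_mul_le hlam (hf_of_ne j hj)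

omit [Countable ι] in
theorem Covers.exists_eq_comp_diagPow (hcov : Covers ν s (fun t => φ t * √t) c)
    (hφ : IsIndexFunction φ) (hlam : lam ∈ Set.Ioc 0 s) (hT : IsDiag e a T)
    (ha : ∀ i, a i ∈ Set.Icc 0 s) (hsource : ∀ h, W h = Co (specFun φ T h)) (hco0 : 0 ≤ co)
    (hco : hsENorm Co ≤ ENNReal.ofReal co) :
    ∃ Z : H →L[ℝ] Y, W = Z ∘L diagPow e (fun i => a i + lam) (ν - 1 / 2) ∧
      hsENorm Z ≤ ENNReal.ofReal (co * (max 1 (1 / c) * φ lam * lam ^ (-(ν - 1 / 2)))) := by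
  have hl := hlam.1
  have hφl := hφ.pos hl
  have hu := add_mem_Icc_of_mem_Icc_zero (lam := lam) ha
  have hΦ := hφ.isDiag_diagOp e ha
  refine ⟨Co ∘L ((diagOp e fun i => φ (a i)) * diagPow e (fun i => a i + lam) (-(ν - 1 / 2))),
    ?_, ?_⟩
  · rw [ContinuousLinearMap.comp_assoc, ← ContinuousLinearMap.mul_def, mul_assoc,
      diagPow_neg_mul_self hl hu, mul_one]
    ext h
    rw [hsource, hT.specFun_apply φ hΦ]
    rfl
  · refine hsENorm_comp_le_ofReal hco0 hco
      ((hΦ.mul (isDiag_diagPow hl hu _)).norm_le (by positivity) fun i => ?_)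
    have hpos : 0 < a i + lam := add_pos_of_nonneg_of_pos (ha i).1 hl
    rw [abs_of_nonneg (mul_nonneg (hφ.nonneg (ha i).1) (by positivity)), Real.rpow_neg hpos.le,
      ← div_eq_mul_inv, div_le_iff₀ (by positivity)]
    exact hcov.le_max_mul_rpow_add hφ hlam (ha i)

theorem bias_constant_le {ν θ lam C cc w η co x : ℝ} {m : ℕ} (hν : ν - 1 / 2 = θ + m)
    (hθ : 0 ≤ θ) (hlam : 0 < lam) (hC : 0 ≤ C) (hcc : 1 ≤ cc) (hw : 0 ≤ w) (hη : 0 ≤ η) :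
    √2 * (2 ^ ν * C) * (m * (w * η) +
        2 ^ θ * (co * (cc * x * lam ^ (-(ν - 1 / 2)))) * lam ^ (θ + m + 1 / 2)) ≤
      2 ^ (2 * ν - m) * C * cc * (m * w * η + co * x * √lam) := by
  have hpow : √2 * 2 ^ ν * 2 ^ θ = (2 : ℝ) ^ (2 * ν - m) := by
    rw [Real.sqrt_eq_rpow, ← Real.rpow_add two_pos, ← Real.rpow_add two_pos]
    congr 1
    linear_combination -hν
  have hsqrt : lam ^ (-(ν - 1 / 2)) * lam ^ (θ + m + 1 / 2) = √lam := by
    rw [← Real.rpow_add hlam, Real.sqrt_eq_rpow, hν, neg_add_cancel_left]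
  calc _ = √2 * 2 ^ ν * 1 * 1 * (C * (m * w * η)) + √2 * 2 ^ ν * 2 ^ θ * C * cc * (co * x *
          (lam ^ (-(ν - 1 / 2)) * lam ^ (θ + m + 1 / 2))) := by ring
    _ ≤ √2 * 2 ^ ν * 2 ^ θ * cc * (C * (m * w * η)) + √2 * 2 ^ ν * 2 ^ θ * C * cc * (co * x *
          (lam ^ (-(ν - 1 / 2)) * lam ^ (θ + m + 1 / 2))) := by
        gcongr
        exact Real.one_le_rpow one_le_two hθ
    _ = _ := by
        rw [hsqrt, hpow]
        ring

theorem HasQualification.hsENorm_bias_le (hν : HasQualification g s ν γν)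
    (hg : IsRegularizationFamily g s D B γ) (hcov : Covers ν s (fun t => φ t * √t) c)
    (hφ : IsIndexFunction φ) (hlam : lam ∈ Set.Ioc 0 s) (hT : IsDiag e a T)
    (hTh : IsDiag e' a' Th) (ha : ∀ i, a i ∈ Set.Icc 0 s) (ha' : ∀ j, a' j ∈ Set.Icc 0 s)
    (hη : ‖(T - Th) * diagPow e (fun i => a i + lam) (-(1 / 2))‖ ≤ η) (hηl : η ≤ √lam / 2)
    (hR : IsDiag e (fun i => √(a i)) R) (hG : IsDiag e' (fun j => g lam (a' j)) G)
    (hsource : ∀ h, W h = Co (specFun φ T h)) (hw0 : 0 ≤ w)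
    (hw : hsENorm W ≤ ENNReal.ofReal w) (hco0 : 0 ≤ co) (hco : hsENorm Co ≤ ENNReal.ofReal co)
    (hm : m ≤ ν - 1 / 2) (hm' : ν - 1 / 2 ≤ m + 1) :
    hsENorm (W ∘L ((1 - Th * G) * R)) ≤ ENNReal.ofReal
      (2 ^ (2 * ν - m) * (γν + γ) * max 1 (1 / c) * (m * w * η + co * φ lam * √lam)) := by
  have hl := hlam.1
  have hγ := hg.γ_pos
  have hγν := hν.const_nonneg (hl.trans_le hlam.2)
  have hφl := hφ.pos hl
  obtain ⟨θ, hθ⟩ : ∃ θ, ν - 1 / 2 = θ + m := ⟨ν - 1 / 2 - m, by ring⟩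
  obtain ⟨Z, rfl, hZ⟩ := hcov.exists_eq_comp_diagPow hφ hlam hT ha hsource hco0 hco
  rw [hθ] at hw ⊢
  refine (hsENorm_comp_diagPow_mul_le hl (hT.add_smul_one lam) (hTh.add_smul_one lam)
    (add_mem_Icc_of_mem_Icc_zero ha) (add_mem_Icc_of_mem_Icc_zero ha')
    (by rwa [add_sub_add_right_eq_sub]) hηl hR (fun i => ?_) (IsDiag.one.sub (hTh.mul hG))
    (c := 2 ^ ν * (γν + γ)) (by positivity) (by positivity) hw0 hZ hw (by linarith) (by linarith)
    fun j p hp => hν.abs_residual_mul_add_rpow_le_of_le hg hlam (ha' j) (by linarith)).trans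
      (ENNReal.ofReal_le_ofReal (bias_constant_le hθ (by linarith) hl (by positivity)
        (le_max_left _ _) hw0 ((norm_nonneg _).trans hη)))
  rw [abs_of_nonneg (Real.sqrt_nonneg _)]
  exact Real.sqrt_le_sqrt (le_add_of_nonneg_right hl.le)

-- `W - Cyx g(Th) = W (1 - Th g(Th)) - (Cyx - W Th) g(Th)`: bias minus sample error.
theorem HasQualification.hsENorm_error_le (hν : HasQualification g s ν γν)
    (hg : IsRegularizationFamily g s D B γ) (hcov : Covers ν s (fun t => φ t * √t) c)
    (hφ : IsIndexFunction φ) (hlam : lam ∈ Set.Ioc 0 s) (hT : IsDiag e a T)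
    (hTh : IsDiag e' a' Th) (ha : ∀ i, a i ∈ Set.Icc 0 s) (ha' : ∀ j, a' j ∈ Set.Icc 0 s)
    (hη : ‖(T - Th) * diagPow e (fun i => a i + lam) (-(1 / 2))‖ ≤ η) (hηl : η ≤ √lam / 2)
    (hR : IsDiag e (fun i => √(a i)) R) (hG : IsDiag e' (fun j => g lam (a' j)) G)
    (hsource : ∀ h, W h = Co (specFun φ T h)) (hw0 : 0 ≤ w)
    (hw : hsENorm W ≤ ENNReal.ofReal w) (hco0 : 0 ≤ co) (hco : hsENorm Co ≤ ENNReal.ofReal co)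
    (hm : m ≤ ν - 1 / 2) (hm' : ν - 1 / 2 ≤ m + 1) {Cyx : H →L[ℝ] Y}
    (hker : ∀ u, Th u = 0 → Cyx u = 0) (hd0 : 0 ≤ d)
    (hd : hsENorm ((Cyx - W ∘L Th) ∘L diagPow e (fun i => a i + lam) (-(1 / 2))) ≤
      ENNReal.ofReal d) :
    hsENorm ((W - Cyx ∘L G) ∘L R) ≤ ENNReal.ofReal
      (2 ^ (2 * ν - m) * (γν + γ) * max 1 (1 / c) * (m * w * η + co * φ lam * √lam) +
        2 * (B + D) * d) := by
  have hB := hg.B_pos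
  have hD := hg.D_pos
  have hγ := hg.γ_pos
  have hγν := hν.const_nonneg (hlam.1.trans_le hlam.2)
  have hφl := hφ.pos hlam.1
  have hη0 := (norm_nonneg _).trans hη
  have hbias := hν.hsENorm_bias_le hg hcov hφ hlam hT hTh ha ha' hη hηl hR hG hsource hw0 hw hco0
    hco hm hm'
  have hsample := hg.hsENorm_sample_error_le hlam hT hTh ha ha' (hη.trans hηl) hR hG
    (ε := Cyx - W ∘L Th) (fun u hu => by simp [hu, hker u hu]) hd0 hd
  have hdecomp : (W - Cyx ∘L G) ∘L R =
      W ∘L ((1 - Th * G) * R) - (Cyx - W ∘L Th) ∘L (G * R) := by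
    ext h
    simp
  rw [hdecomp, ENNReal.ofReal_add (by positivity) (by positivity)]
  exact (hsENorm_sub_le _ _).trans (add_le_add hbias hsample)

end Error

section Constants

variable {lam b κ N : ℝ}

theorem bnl_eq_two_mul {n : ℕ} (hκ : 0 ≤ κ) :
    Bnl n lam b κ N = 2 * κ * (2 * b * (κ / √lam) / n + √(b * N / n)) := by
  rw [Bnl, show b * κ ^ 2 * N / n = κ ^ 2 * (b * N / n) by ring, Real.sqrt_mul (sq_nonneg κ),
    Real.sqrt_sq hκ, ← div_div]
  ring

theorem error_constants_eq {ν γ' cc M BD w co x t n m : ℝ} (hb : 0 ≤ b) :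
    2 ^ (2 * ν - m) * γ' * cc *
        (m * w * (2 * κ * (2 * b * (κ / √lam) / n + √(b * N / n)) * t) + co * x * √lam) +
      2 * BD * (5 / 2 * M * (2 * b * (κ / √lam) / n + √(b * N / n)) * t) =
    ((2 ^ (2 * ν - m + 2) * γ' * cc * m * b * κ ^ 2 * w + 10 * b * M * κ * BD) / n * √(1 / lam) +
        (2 ^ (2 * ν - m + 1) * γ' * cc * m * √b * κ * w + 5 * M * √b * BD) * √(N / n)) * t +
      2 ^ (2 * ν - m) * γ' * cc * co * √lam * x := by
  rw [mul_div_assoc b, Real.sqrt_mul hb, one_div, Real.sqrt_inv, Real.rpow_add two_pos,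
    Real.rpow_add two_pos, Real.rpow_one, Real.rpow_two]
  ring

end Constants

theorem exists_measurableSet_hsENorm_deviation_comp_diagPow_le {X H Y ι : Type*}
    [MeasurableSpace X] [NormedAddCommGroup H] [InnerProductSpace ℝ H] [CompleteSpace H]
    [TopologicalSpace.SeparableSpace H] [RKHS ℝ H X ℝ] [NormedAddCommGroup Y]
    [InnerProductSpace ℝ Y] [CompleteSpace Y] [TopologicalSpace.SeparableSpace Y]
    [MeasurableSpace Y] [BorelSpace Y] {pX qX : Measure X} [IsProbabilityMeasure pX]
    [IsProbabilityMeasure qX] {K : Kernel X Y} [IsMarkovKernel K] {κ : ℝ} (hκ : 0 ≤ κ)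
    (hk_meas : ∀ t : X, Measurable fun x => scalarKernel H x t)
    (hk : ∀ x : X, scalarKernel H x x ≤ κ ^ 2) {β : X → ℝ} {b : ℝ}
    (hβ : IsBoundedDensity β b pX qX) {M' : ℝ} (hM' : ∀ᵐ z ∂(pX ⊗ₘ K), ‖z.2‖ ≤ M')
    {W : H →L[ℝ] Y} {w : ℝ} (hw : ‖W‖ ≤ w)
    (hreg : ∀ᵐ x ∂qX, regressionFun K x = W (featureMap H x)) {e : HilbertBasis ι ℝ H}
    {a : ι → ℝ} {s lam : ℝ} (hT : IsDiag e a (covOp H qX)) (ha : ∀ i, a i ∈ Set.Icc 0 s)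
    (hlam : 0 < lam) {n : ℕ} (hn : n ≠ 0) {δ : ℝ} (hδ0 : 0 < δ) (hδ1 : δ < 1) :
    ∃ E : Set (Fin n → X × Y), MeasurableSet E ∧
      ENNReal.ofReal (1 - δ) ≤ Measure.pi (fun _ : Fin n => pX ⊗ₘ K) E ∧
      ∀ z ∈ E,
        hsENorm ((empCovOp H β z - covOp H qX) ∘L diagPow e (fun i => a i + lam) (-(1 / 2))) ≤
          ENNReal.ofReal (2 * κ * (2 * b * (κ / √lam) / n +
            √(b * effDim (covOp H qX) lam / n)) * Real.log (2 / δ)) ∧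
        hsENorm ((empCrossCovOp H β z - W ∘L empCovOp H β z) ∘L
            diagPow e (fun i => a i + lam) (-(1 / 2))) ≤
          ENNReal.ofReal (5 / 2 * (M' + w * κ) * (2 * b * (κ / √lam) / n +
            √(b * effDim (covOp H qX) lam / n)) * Real.log (2 / δ)) := by
  have := UniformSpace.secondCountable_of_separable Y
  have hφκ : ∀ x, ‖(featureMap H x : H)‖ ≤ κ := fun x => norm_featureMap_le hκ (hk x)
  have hu := add_mem_Icc_of_mem_Icc_zero (lam := lam) ha
  have hS : ‖diagPow e (fun i => a i + lam) (-(1 / 2))‖ ≤ 1 / √lam := by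
    rw [Real.sqrt_eq_rpow, one_div (lam ^ _), ← Real.rpow_neg hlam.le]
    exact norm_diagPow_le hlam hu (by norm_num)
  have h := exists_measurableSet_hsENorm_deviation_le hβ (stronglyMeasurable_featureMap hk_meas)
    hφκ (fun x => W.le_of_opNorm_le_of_le hw (hφκ x)) hM' hreg
    (isDiag_diagPow hlam hu _).isSymmetric
    (fun x => ContinuousLinearMap.le_of_opNorm_le_of_le _ hS (hφκ x)) hn hδ0 hδ1
  rwa [one_div_mul_eq_div, integral_norm_diagPow_featureMap_sq
    (memLp_featureMap qX hκ hk_meas hk 2) hT ha hlam] at h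

theorem eLpNorm_regressionFun_sub_estimator_le {X H Y ι : Type*} [Countable ι] [MeasurableSpace X]
    [NormedAddCommGroup H] [InnerProductSpace ℝ H] [CompleteSpace H]
    [TopologicalSpace.SeparableSpace H] [RKHS ℝ H X ℝ] [NormedAddCommGroup Y]
    [InnerProductSpace ℝ Y] [CompleteSpace Y] [TopologicalSpace.SeparableSpace Y]
    [MeasurableSpace Y] {qX : Measure X} (hfm : MemLp (featureMap H : X → H) 2 qX)
    {K : Kernel X Y} {W Co : H →L[ℝ] Y}
    (hreg : ∀ᵐ x ∂qX, regressionFun K x = W (featureMap H x))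
    {φ : ℝ → ℝ} (hφ : IsIndexFunction φ)
    (hsource : ∀ h : H, W h = Co (specFun φ (covOp H qX) h)) {w co : ℝ} (hw0 : 0 ≤ w)
    (hw : hsENorm W ≤ ENNReal.ofReal w) (hco0 : 0 ≤ co) (hco : hsENorm Co ≤ ENNReal.ofReal co)
    {g : ℝ → ℝ → ℝ} {s D B γ ν γν c : ℝ} (hg : IsRegularizationFamily g s D B γ)
    (hν : HasQualification g s ν γν) (hcov : Covers ν s (fun t => φ t * √t) c)
    {lam : ℝ} (hlam : lam ∈ Set.Ioc 0 s) {m : ℕ} (hm : m ≤ ν - 1 / 2) (hm' : ν - 1 / 2 ≤ m + 1)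
    {e : HilbertBasis ι ℝ H} {a : ι → ℝ} (hT : IsDiag e a (covOp H qX))
    (ha : ∀ i, a i ∈ Set.Icc 0 s) {n : ℕ} {β : X → ℝ} (hβ : ∀ x, 0 ≤ β x)
    {z : Fin n → X × Y} (hz : ‖empCovOp H β z‖ ≤ s) {η d : ℝ} (hη0 : 0 ≤ η) (hηl : η ≤ √lam / 2)
    (hη : hsENorm ((empCovOp H β z - covOp H qX) ∘L diagPow e (fun i => a i + lam) (-(1 / 2))) ≤
      ENNReal.ofReal η) (hd0 : 0 ≤ d)
    (hd : hsENorm ((empCrossCovOp H β z - W ∘L empCovOp H β z) ∘L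
      diagPow e (fun i => a i + lam) (-(1 / 2))) ≤ ENNReal.ofReal d) :
    eLpNorm (fun x => regressionFun K x - estimator H β (g lam) z x) 2 qX ≤ ENNReal.ofReal
      (2 ^ (2 * ν - m) * (γν + γ) * max 1 (1 / c) * (m * w * η + co * φ lam * √lam) +
        2 * (B + D) * d) := by
  obtain ⟨ι', e', a', hTh, ha'⟩ := exists_hilbertBasis_isDiag_mem_Icc
    (isCompactOperator_empCovOp z) (isPositive_empCovOp hβ z) hz
  have := countable_of_hilbertBasis e'
  have hG := hg.isDiag_diagOp hlam e' ha'
  have hR := isDiag_diagOp_sqrt e ha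
  have hae : (fun x => regressionFun K x - estimator H β (g lam) z x) =ᵐ[qX] fun x =>
      (W - empCrossCovOp H β z ∘L diagOp e' fun j => g lam (a' j)) (featureMap H x) := by
    filter_upwards [hreg] with x hx
    rw [hx, estimator, hTh.specFun_apply (g lam) hG]
    rfl
  rw [eLpNorm_congr_ae hae, eLpNorm_apply_featureMap hfm hR.isSymmetric.isSelfAdjoint
    (hT.diagOp_sqrt_mul_self ha)]
  refine hν.hsENorm_error_le hg hcov hφ hlam hT hTh ha ha' ?_ hηl hR hG hsource hw0 hw hco0 hco
    hm hm' (fun u hu => empCrossCovOp_apply_eq_zero hβ z hu) hd0 hd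
  rw [← neg_sub, neg_mul, norm_neg]
  exact opNorm_le_of_hsENorm_le hη0 hη

end CovariateShift

end

open CovariateShift in
theorem mainTheorem1
    {X H Y : Type*} [MeasurableSpace X]
    -- the scalar reproducing kernel Hilbert space and the output space
    [NormedAddCommGroup H] [InnerProductSpace ℝ H] [CompleteSpace H]
    [TopologicalSpace.SeparableSpace H] [RKHS ℝ H X ℝ]
    [NormedAddCommGroup Y] [InnerProductSpace ℝ Y] [CompleteSpace Y]
    [TopologicalSpace.SeparableSpace Y] [MeasurableSpace Y] [BorelSpace Y]
    -- source and target input distributions, and the common conditional distribution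
    (pX qX : Measure X) [IsProbabilityMeasure pX] [IsProbabilityMeasure qX]
    (K : Kernel X Y) [IsMarkovKernel K]
    -- bounded measurable kernel
    (κ : ℝ) (hκ : 0 ≤ κ)
    (hk_meas : ∀ t : X, Measurable fun x => scalarKernel H x t)
    (hk : ∀ x : X, scalarKernel H x x ≤ κ ^ 2)
    -- bounded importance weight
    (β : X → ℝ) (b : ℝ) (hβ_meas : Measurable β) (hβ_nonneg : ∀ x, 0 ≤ β x)
    (hβ_le : ∀ x, β x ≤ b) (hqX : qX = pX.withDensity fun x => ENNReal.ofReal (β x))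
    -- bounded outputs
    (M' : ℝ) (hM' : ∀ᵐ z ∂(pX ⊗ₘ K), ‖z.2‖ ≤ M')
    -- the regression function is `C_* φ(·)`, with the general source condition
    (φ : ℝ → ℝ) (hφ : IsIndexFunction φ) (Cstar Co : H →L[ℝ] Y)
    (hCstar : IsHilbertSchmidt Cstar) (hCo : IsHilbertSchmidt Co)
    (hreg : ∀ᵐ x ∂qX, regressionFun K x = Cstar (featureMap H x))
    (hsource : ∀ h : H, Cstar h = Co (specFun φ (covOp H qX) h))
    -- regularization family on an interval that contains the spectra
    (g : ℝ → ℝ → ℝ) (s D B γ ν γν c : ℝ) (hs : b * κ ^ 2 ≤ s)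
    (hg : IsRegularizationFamily g s D B γ) (hν : HasQualification g s ν γν)
    (hcov : Covers ν s (fun t => φ t * √t) c)
    -- sample size, confidence level, regularization parameter
    (n : ℕ) (hn : 1 ≤ n) (δ : ℝ) (hδ0 : 0 < δ) (hδ1 : δ < 1)
    (lam : ℝ) (hlam : 0 < lam) (hlams : lam ≤ s)
    (hcond : Bnl n lam b κ (effDim (covOp H qX) lam) * Real.log (2 / δ) ≤ √lam / 2)
    -- the constants
    (νbar M A₁ A₂ A₃ : ℝ) (hνbar : νbar = (⌊ν - 1 / 2⌋ : ℤ))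
    (hM : M = M' + hsNorm Cstar * κ)
    (hA₁ : A₁ = 2 ^ (2 * ν - νbar + 2) * (γν + γ) * max 1 (1 / c) * νbar * b * κ ^ 2
        * hsNorm Cstar + 10 * b * M * κ * (B + D))
    (hA₂ : A₂ = 2 ^ (2 * ν - νbar + 1) * (γν + γ) * max 1 (1 / c) * νbar * √b * κ
        * hsNorm Cstar + 5 * M * √b * (B + D))
    (hA₃ : A₃ = 2 ^ (2 * ν - νbar) * (γν + γ) * max 1 (1 / c) * hsNorm Co) :
    ∃ E : Set (Fin n → X × Y), MeasurableSet E ∧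
      ENNReal.ofReal (1 - δ) ≤ Measure.pi (fun _ : Fin n => pX ⊗ₘ K) E ∧
      ∀ z ∈ E,
        eLpNorm (fun x => regressionFun K x - estimator H β (g lam) z x) 2 qX ≤
          ENNReal.ofReal
            ((A₁ / n * √(1 / lam) + A₂ * √(effDim (covOp H qX) lam / n)) * Real.log (2 / δ)
              + A₃ * √lam * φ lam) := by
  have hβ : IsBoundedDensity β b pX qX := ⟨hβ_meas, hβ_nonneg, hβ_le, hqX⟩
  have hb0 : 0 ≤ b := zero_le_one.trans hβ.one_le
  have hfm := memLp_featureMap qX hκ hk_meas hk 2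
  have hw0 : 0 ≤ hsNorm Cstar := Real.sqrt_nonneg _
  have hw := (hsENorm_eq_ofReal_hsNorm hCstar).le
  have hco := (hsENorm_eq_ofReal_hsNorm hCo).le
  have hM0 : 0 ≤ M' + hsNorm Cstar * κ :=
    add_nonneg (hM'.exists.elim fun _ hz => (norm_nonneg _).trans hz) (mul_nonneg hw0 hκ)
  have hlog : 0 ≤ Real.log (2 / δ) := Real.log_nonneg ((one_le_div hδ0).2 (by linarith))
  have hν0 : 0 ≤ ν - 1 / 2 := by linarith [hcov.half_lt hφ (hlam.trans_le hlams)]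
  obtain ⟨ι, e, a, hT, ha⟩ := exists_hilbertBasis_isDiag_mem_Icc (isCompactOperator_covOp hfm)
    (isPositive_covOp hfm) (((norm_covOp_le fun x => norm_featureMap_le hκ (hk x)).trans
      (le_mul_of_one_le_left (sq_nonneg κ) hβ.one_le)).trans hs)
  have := countable_of_hilbertBasis e
  obtain ⟨E, hE, hEδ, hdev⟩ := exists_measurableSet_hsENorm_deviation_comp_diagPow_le hκ hk_meas
    hk hβ hM' (opNorm_le_of_hsENorm_le hw0 hw) hreg hT ha hlam (Nat.one_le_iff_ne_zero.1 hn) hδ0 hδ1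
  rw [bnl_eq_two_mul hκ] at hcond
  rw [hA₁, hA₂, hA₃, hνbar, ← natCast_floor_eq_intCast_floor hν0, ← error_constants_eq hb0, hM]
  exact ⟨E, hE, hEδ, fun z hz => eLpNorm_regressionFun_sub_estimator_le hfm hreg hφ hsource hw0 hw
    (Real.sqrt_nonneg _) hco hg hν hcov ⟨hlam, hlams⟩ (Nat.floor_le hν0)
    (Nat.lt_floor_add_one _).le hT ha hβ_nonneg
    ((norm_empCovOp_le hκ hk hb0 hβ_nonneg hβ_le z).trans hs) (by positivity) hcond
    (hdev z hz).1 (by positivity) (hdev z hz).2⟩
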